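/- **Setting.** Let $\mathcal X$ be a measurable space, $k$ a (jointly measurable) real positive semidefinite kernel on $\mathcal X$ with reproducing kernel Hilbert space $\mathcal H_k$ and unit ball $\mathcal B(\mathcal H_k)$, and suppose $k(x,x')\le\kappa$ for all $x,x'$. Let $\mathcal Y\subseteq\mathbb R$, let $(X,Y)\sim P$ be a random pair in $\mathcal X\times\mathcal Y$, and let $(x_i,y_i)_{i=1}^n$, $n\ge 1$, be i.i.d. draws from $P$. Let $\ell:\mathbb R\times\mathbb R\to\mathbb R$ be a measurable loss with $0\le\ell(z,y)\le 2$ whenever $y\in\mathcal Y$ and $|z|\le\sqrt\kappa$ (the range of the functions of $\mathcal B(\mathcal H_k)$). Write $\mathbb E[\ell_f]=\mathbb E[\ell(f(X),Y)]$, and suppose that $f\mapsto\mathbb E[\ell_f]$ is minimised over $\mathcal H_k$ at some $f_{\mathcal H_k}\in\mathcal B(\mathcal H_k)$. Let $K=(k(x_i,x_j))_{i,j}$ and let $K/n=UDU^\top$ be an eigendecomposition with $U$ orthogonal and $D=\mathrm{diag}(\mu_1,\dots,\mu_n)$, $\mu_1\ge\dots\ge\mu_n$. Let $\delta_n$ be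 the smallest positive $r$ (infimum) with $\big(\frac1n\sum_{i=1}^n\min(r^2,\mu_i)\big)^{1/2}\le r^2$, and let $d_n$ be the smallest $j\in\{1,\dots,n\}$ with $\mu_j\le\delta_n^2$ ($d_n=n$ if there is none). Let $U_1$ be the first $d_n$ columns of $U$, $U_2$ the remaining ones, and $D_2=\mathrm{diag}(\mu_{d_n+1},\dots,\mu_n)$. For $c>0$, a matrix $S\in\mathbb R^{s\times n}$ is $K$-satisfiable for $c$ if $$\|(SU_1)^\top SU_1-I_{d_n}\|_{\mathrm{op}}\le\tfrac12\quad\text{and}\quad\|SU_2D_2^{1/2}\|_{\mathrm{op}}\le c\,\delta_n .$$ For $\lambda_n>0$ and $S\in\mathbb R^{s\times n}$ let $\tilde f_s=\sum_{i=1}^n[S^\top\tilde\gamma]_i\,k(\cdot,x_i)$, where $\tilde\gamma$ minimises $$\frac1n\sum_{i=1}^n\ell([KS^\top\gamma]_i,y_i)+\frac{\lambda_n}2\gamma^\top SKS^\top\gamma$$ over all $\gamma\in\mathbb R^s$ with $\sum_i[S^\top\gamma]_ik(\cdot,x_i)\in\mathcal B(\mathcal H_k)$. **Theorem.** Let $c>0$,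 $C=1+\sqrt6\,c$ and $\delta\in(0,1)$. 1. If $z\mapsto\ell(z,y)$ is $L$-Lipschitz for every $y\in\mathcal Y$, then there is an event of probability at least $1-\delta$ over the sample on which, for every $S\in\mathbb R^{s\times n}$ that is $K$-satisfiable for $c$ and every corresponding $\tilde f_s$, $$\mathbb E[\ell_{\tilde f_s}]\le\mathbb E[\ell_{f_{\mathcal H_k}}]+LC\sqrt{\lambda_n+\delta_n^2}+\frac{\lambda_n}2+8L\sqrt{\frac\kappa n}+2\sqrt{\frac{8\log(4/\delta)}n}.$$ 2. If $\ell(z,y)=(z-y)^2/2$ and $\mathcal Y\subseteq[0,1]$ (then the bound $\ell\le 2$ holds as soon as $\kappa\le1$), then there is an event of probability at least $1-\delta$ over the sample on which, for every $S\in\mathbb R^{s\times n}$ that is $K$-satisfiable for $c$ and every corresponding $\tilde f_s$, $$\mathbb E[\ell_{\tilde f_s}]\le\mathbb E[\ell_{f_{\mathcal H_k}}]+\Big(C^2+\frac12\Big)\lambda_n+C^2\delta_n^2+8\,\frac{\kappa+\sqrt\kappa}{\sqrt n}+2\sqrt{\frac{8\log(4/\delta)}n}.$$ -/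

import Mathlib

open MeasureTheory Set
open scoped NNReal ENNReal Matrix Matrix.Norms.L2Operator

noncomputable section

namespace SketchedKernel

/-- The scalar kernel `k(x, x')` of a real-valued reproducing kernel Hilbert space `H`. -/
def ker {X : Type*} (H : Type*) [NormedAddCommGroup H] [InnerProductSpace ℝ H] [CompleteSpace H]
    [RKHS ℝ H X ℝ] (x x' : X) : ℝ :=
  RKHS.kernel H x x' 1

/-- The element `k(·, x)` of the reproducing kernel Hilbert space `H`. -/
def kerSection {X : Type*} (H : Type*) [NormedAddCommGroup H] [InnerProductSpace ℝ H]
    [CompleteSpace H] [RKHS ℝ H X ℝ] (x : X) : H :=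
  RKHS.kerFun H x 1

theorem kerSection_apply {X : Type*} (H : Type*) [NormedAddCommGroup H] [InnerProductSpace ℝ H]
    [CompleteSpace H] [RKHS ℝ H X ℝ] (x x' : X) : kerSection H x' x = ker H x x' := by
  simp [ker, kerSection, RKHS.kerFun_apply]

/-- The Gram matrix `K_{ij} = k(x_i, x_j)` of a sample of inputs. -/
def gram {X : Type*} (H : Type*) [NormedAddCommGroup H] [InnerProductSpace ℝ H] [CompleteSpace H]
    [RKHS ℝ H X ℝ] {n : ℕ} (x : Fin n → X) : Matrix (Fin n) (Fin n) ℝ :=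
  Matrix.of fun i j => ker H (x i) (x j)

/-- `A = U diag(μ) Uᵀ` with `U` orthogonal and the eigenvalues `μ` in decreasing order. -/
structure IsEigendecomposition {n : ℕ} (A U : Matrix (Fin n) (Fin n) ℝ) (μ : Fin n → ℝ) :
    Prop where
  orthogonal : Uᵀ * U = 1
  eq_mul : A = U * Matrix.diagonal μ * Uᵀ
  antitone : Antitone μ

/-- The critical radius `δ_n` of the eigenvalues `μ_1, …, μ_n`: the smallest positive `r` with
`((1/n) ∑ min(r², μ_i))^{1/2} ≤ r²` (and `0` when all eigenvalues vanish). -/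
def criticalRadius {n : ℕ} (μ : Fin n → ℝ) : ℝ :=
  sInf {r : ℝ | 0 < r ∧ √((1 / (n : ℝ)) * ∑ i, min (r ^ 2) (μ i)) ≤ r ^ 2}

/-- The statistical dimension `d_n`: the smallest `j ∈ {1, …, n}` with `μ_j ≤ δ_n²`, and `n` if
there is none. The eigenvalue `μ_j` is `μ i` for the index `i` with value `j - 1`. -/
def statDim {n : ℕ} (μ : Fin n → ℝ) : ℕ :=
  sInf ({j : ℕ | ∃ i : Fin n, j = (i : ℕ) + 1 ∧ μ i ≤ criticalRadius μ ^ 2} ∪ {n})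

/-- The first `d` columns of `U`. -/
def leftBlock {n : ℕ} (U : Matrix (Fin n) (Fin n) ℝ) (d : ℕ) :
    Matrix (Fin n) {j : Fin n // (j : ℕ) < d} ℝ :=
  U.submatrix id Subtype.val

/-- The columns of `U` after the first `d`. -/
def rightBlock {n : ℕ} (U : Matrix (Fin n) (Fin n) ℝ) (d : ℕ) :
    Matrix (Fin n) {j : Fin n // d ≤ (j : ℕ)} ℝ :=
  U.submatrix id Subtype.val

/-- `K`-satisfiability for `c` of a sketch matrix `S`, where `K / n = U diag(μ) Uᵀ`. The matrix
norms are operator norms with respect to the Euclidean norms. -/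
def IsSatisfiable {n s : ℕ} (U : Matrix (Fin n) (Fin n) ℝ) (μ : Fin n → ℝ) (c : ℝ)
    (S : Matrix (Fin s) (Fin n) ℝ) : Prop :=
  ‖(S * leftBlock U (statDim μ))ᵀ * (S * leftBlock U (statDim μ)) - 1‖ ≤ 1 / 2 ∧
  ‖S * rightBlock U (statDim μ) *
      Matrix.diagonal (fun j : {j : Fin n // statDim μ ≤ (j : ℕ)} => √(μ j))‖
    ≤ c * criticalRadius μ

/-- The true risk `E[ℓ(f(X), Y)]`. -/
def risk {X : Type*} [MeasurableSpace X] (P : Measure (X × ℝ)) (ℓ : ℝ → ℝ → ℝ) (f : X → ℝ) : ℝ :=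
  ∫ p, ℓ (f p.1) p.2 ∂P

/-- The function `∑ i, [Sᵀ γ]_i k(·, x_i)`. -/
def sketchedFun {X : Type*} (H : Type*) [NormedAddCommGroup H] [InnerProductSpace ℝ H]
    [CompleteSpace H] [RKHS ℝ H X ℝ] {n s : ℕ} (x : Fin n → X) (S : Matrix (Fin s) (Fin n) ℝ)
    (γ : Fin s → ℝ) : H :=
  ∑ i, (Sᵀ *ᵥ γ) i • kerSection H (x i)

/-- The sketched objective
`(1/n) ∑ ℓ([K Sᵀ γ]_i, y_i) + (lam/2) γᵀ S K Sᵀ γ`. -/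
def sketchedObjective {X : Type*} (H : Type*) [NormedAddCommGroup H] [InnerProductSpace ℝ H]
    [CompleteSpace H] [RKHS ℝ H X ℝ] {n s : ℕ} (ℓ : ℝ → ℝ → ℝ) (lam : ℝ)
    (x : Fin n → X) (y : Fin n → ℝ) (S : Matrix (Fin s) (Fin n) ℝ) (γ : Fin s → ℝ) : ℝ :=
  (1 / (n : ℝ)) * ∑ i, ℓ (((gram H x * Sᵀ) *ᵥ γ) i) (y i)
    + lam / 2 * (γ ⬝ᵥ (S * gram H x * Sᵀ) *ᵥ γ)

/-- `γ` solves the sketched problem over the hypothesis set given by the unit ball of `H`. A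
solution of the problem over all coefficient vectors whose function lies in the unit ball is in
particular a solution in this sense. -/
def IsSketchedSolution {X : Type*} (H : Type*) [NormedAddCommGroup H] [InnerProductSpace ℝ H]
    [CompleteSpace H] [RKHS ℝ H X ℝ] {n s : ℕ} (ℓ : ℝ → ℝ → ℝ) (lam : ℝ)
    (x : Fin n → X) (y : Fin n → ℝ) (S : Matrix (Fin s) (Fin n) ℝ) (γ : Fin s → ℝ) : Prop :=
  ‖sketchedFun H x S γ‖ ≤ 1 ∧
  ∀ γ' : Fin s → ℝ, ‖sketchedFun H x S γ'‖ ≤ 1 →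
    sketchedObjective H ℓ lam x y S γ ≤ sketchedObjective H ℓ lam x y S γ'

end SketchedKernel

end

/-! The risk of the sketched solution is compared with its empirical risk uniformly over the unit
ball, the empirical risk is compared with that of a good competitor, and the competitor is brought
back to the risk of `fH`.

The competitor is the orthogonal projection of `fH` onto the space of sketched functions. Its norm
is at most 1, so it is admissible and its penalty costs at most `lam / 2`. The residual `g` also has
norm at most 1, and a duality argument makes it small on the sample. With `v i = g (x i)`, the
reproducing property gives `‖v‖² = ⟨g, ∑ v i • k(·, x i)⟩`. As `g` is orthogonal to the sketched
functions, any `Sᵀ γ` may be subtracted from `v` in the sum, and Cauchy–Schwarz bounds `‖v‖²` by the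
norm of what remains. Satisfiability supplies a `γ` for which this norm is at most `√n (1 + √2 c)
δ_n ‖v‖` (`exists_sketch_approx`): the leading eigendirections are cancelled exactly and the others
have eigenvalue at most `δ_n²`. Dividing by `‖v‖` gives `exists_sketchedFun_approx`. The constant
`√6` and the terms pairing `C` with `lam` are slack.

The uniform bound `uniform_deviation` is McDiarmid's inequality combined with symmetrisation and
contraction. For a Lipschitz loss the residual then costs `L` times its empirical norm. For the
squared loss the expansion around `fH` has a quadratic part, of order `δ_n²`, and a part linear in
the residual. First order optimality of `fH` makes the latter centred, so a second uniform deviation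
bound, over all residuals, controls it at rate `1 / √n`; bounding it by Cauchy–Schwarz would lose a
whole `δ_n`. -/

namespace SketchedKernel

/-! ### Concentration under bounded differences -/

section BoundedDifferences

variable {Z : Type*} [MeasurableSpace Z]

theorem integrable_of_abs_le {P : Measure Z} [IsFiniteMeasure P] {f : Z → ℝ} (hf : Measurable f)
    {M : ℝ} (hM : ∀ z, |f z| ≤ M) : Integrable f P :=
  Integrable.of_bound hf.aestronglyMeasurable M (Filter.Eventually.of_forall hM)

/-- Hoeffding's lemma for a function of oscillation at most `c`. -/
theorem integral_exp_le_of_oscillation {P : Measure Z} [IsProbabilityMeasure P] {f : Z → ℝ}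
    (hf : Measurable f) {c : ℝ} (hc : ∀ z z', f z - f z' ≤ c) (t : ℝ) :
    ∫ z, Real.exp (t * f z) ∂P ≤ Real.exp (t * ∫ z, f z ∂P + (c / 2) ^ 2 * t ^ 2 / 2) := by
  obtain ⟨z₀⟩ := P.nonempty_of_neZero
  have hbdd : BddBelow (range f) := ⟨f z₀ - c, by rintro _ ⟨z, rfl⟩; linarith [hc z₀ z]⟩
  set a := ⨅ z, f z with ha
  have : Nonempty Z := ⟨z₀⟩
  have hmem : ∀ z, f z ∈ Icc a (a + c) := fun z => ⟨ciInf_le hbdd z, by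
    have : f z - c ≤ a := le_ciInf fun z' => by linarith [hc z z']
    linarith⟩
  have h := (ProbabilityTheory.hasSubgaussianMGF_of_mem_Icc (μ := P) hf.aemeasurable
    (Filter.Eventually.of_forall hmem)).mgf_le t
  have hc2 : (((‖(a + c) - a‖₊ / 2) ^ 2 : ℝ≥0) : ℝ) = (c / 2) ^ 2 := by
    simp [div_pow]
  rw [hc2, ProbabilityTheory.mgf] at h
  have key : ∫ z, Real.exp (t * f z) ∂P
      = Real.exp (t * ∫ z, f z ∂P) * ∫ z, Real.exp (t * (f z - ∫ z, f z ∂P)) ∂P := by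
    rw [← integral_const_mul]
    congr 1; ext z
    rw [← Real.exp_add]; ring_nf
  rw [key, Real.exp_add]
  exact mul_le_mul_of_nonneg_left h (Real.exp_pos _).le

/-- McDiarmid's inequality, in terms of the moment generating function. -/
theorem integral_exp_le_of_boundedDifferences {P : Measure Z} [IsProbabilityMeasure P] {c M : ℝ}
    (t : ℝ) : ∀ (n : ℕ) (f : (Fin n → Z) → ℝ), Measurable f → (∀ D, |f D| ≤ M) →
    (∀ i D z, f (Function.update D i z) - f D ≤ c) →
    ∫ D, Real.exp (t * f D) ∂(Measure.pi fun _ => P) ≤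
      Real.exp (t * ∫ D, f D ∂(Measure.pi fun _ => P) + n * ((c / 2) ^ 2 * t ^ 2 / 2)) := by
  intro n
  induction n with
  | zero =>
    intro f _ _ _
    rw [Measure.pi_of_empty, integral_dirac, integral_dirac]
    simp
  | succ n ih =>
    intro f hf hM hc
    have mp := (measurePreserving_piFinSuccAbove (fun _ : Fin (n + 1) => P) 0).symm
    have hsymm : ∀ p : Z × (Fin n → Z),
        (MeasurableEquiv.piFinSuccAbove (fun _ : Fin (n + 1) => Z) 0).symm p
          = Fin.cons p.1 p.2 := by
      intro p
      simp [MeasurableEquiv.piFinSuccAbove, Fin.insertNthEquiv]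
    have hcons : Measurable fun p : Z × (Fin n → Z) => f (Fin.cons p.1 p.2) := by
      have := hf.comp (MeasurableEquiv.piFinSuccAbove (fun _ : Fin (n + 1) => Z) 0).symm.measurable
      simpa only [Function.comp_def, hsymm] using this
    have transfer : ∀ g : (Fin (n + 1) → Z) → ℝ,
        (Integrable (fun p : Z × (Fin n → Z) => g (Fin.cons p.1 p.2))
          (P.prod (Measure.pi fun _ => P))) →
        ∫ D, g D ∂(Measure.pi fun _ => P)
          = ∫ D, ∫ z, g (Fin.cons z D) ∂P ∂(Measure.pi fun _ => P) := by
      intro g hg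
      rw [← mp.integral_comp' g]
      simp_rw [hsymm]
      exact integral_prod_symm _ hg
    have hexpM : ∀ D, |Real.exp (t * f D)| ≤ Real.exp (|t| * M) := by
      intro D
      rw [abs_of_pos (Real.exp_pos _), Real.exp_le_exp]
      calc t * f D ≤ |t * f D| := le_abs_self _
        _ = |t| * |f D| := abs_mul _ _
        _ ≤ |t| * M := mul_le_mul_of_nonneg_left (hM D) (abs_nonneg t)
    have hinte : Integrable (fun p : Z × (Fin n → Z) => Real.exp (t * f (Fin.cons p.1 p.2)))
        (P.prod (Measure.pi fun _ => P)) :=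
      integrable_of_abs_le (hcons.const_mul t).exp fun p => hexpM _
    have hint : Integrable (fun p : Z × (Fin n → Z) => f (Fin.cons p.1 p.2))
        (P.prod (Measure.pi fun _ => P)) :=
      integrable_of_abs_le hcons fun p => hM _
    rw [transfer _ hint, transfer (fun D => Real.exp (t * f D)) hinte]
    have hslice : ∀ D : Fin n → Z, Measurable fun z => f (Fin.cons z D) := fun D =>
      hcons.comp (measurable_id.prodMk measurable_const)
    have hsliceint : ∀ D : Fin n → Z, Integrable (fun z => f (Fin.cons z D)) P := fun D =>
      integrable_of_abs_le (hslice D) fun _ => hM _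
    -- Averaging out the first coordinate preserves the bounded differences in the others, so the
    -- induction hypothesis applies to `F`; Hoeffding's lemma pays for the first coordinate.
    set F : (Fin n → Z) → ℝ := fun D => ∫ z, f (Fin.cons z D) ∂P with hF
    have hFmeas : Measurable F :=
      (hcons.stronglyMeasurable.integral_prod_left').measurable
    have hFM : ∀ D, |F D| ≤ M := fun D => by
      have := norm_integral_le_of_norm_le_const (μ := P) (f := fun z => f (Fin.cons z D)) (C := M)
        (Filter.Eventually.of_forall fun z => hM (Fin.cons z D))
      simpa using this
    have hFc : ∀ i D z, F (Function.update D i z) - F D ≤ c := by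
      intro i D z
      rw [hF]
      dsimp only
      rw [← integral_sub (hsliceint _) (hsliceint _)]
      calc _ ≤ ∫ _, c ∂P := by
            refine integral_mono ((hsliceint _).sub (hsliceint _)) (integrable_const _) fun w => ?_
            have := hc i.succ (Fin.cons w D) z
            rwa [← Fin.cons_update] at this
        _ = c := by simp
    have step : ∀ D : Fin n → Z, ∫ z, Real.exp (t * f (Fin.cons z D)) ∂P
        ≤ Real.exp ((c / 2) ^ 2 * t ^ 2 / 2) * Real.exp (t * F D) := by
      intro D
      rw [← Real.exp_add, add_comm (_ / 2)]
      refine integral_exp_le_of_oscillation (hslice D) (fun z z' => ?_) t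
      have := hc 0 (Fin.cons z' D) z
      rwa [Fin.update_cons_zero] at this
    have hexpF : Integrable (fun D => Real.exp (t * F D)) (Measure.pi fun _ : Fin n => P) := by
      refine integrable_of_abs_le (by fun_prop) (M := Real.exp (|t| * M)) fun D => ?_
      rw [abs_of_pos (Real.exp_pos _), Real.exp_le_exp]
      calc t * F D ≤ |t * F D| := le_abs_self _
        _ = |t| * |F D| := abs_mul _ _
        _ ≤ |t| * M := mul_le_mul_of_nonneg_left (hFM D) (abs_nonneg t)
    calc ∫ D, ∫ z, Real.exp (t * f (Fin.cons z D)) ∂P ∂(Measure.pi fun _ => P)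
        ≤ ∫ D, Real.exp ((c / 2) ^ 2 * t ^ 2 / 2) * Real.exp (t * F D)
            ∂(Measure.pi fun _ => P) :=
          integral_mono hinte.integral_prod_right (hexpF.const_mul _) step
      _ = Real.exp ((c / 2) ^ 2 * t ^ 2 / 2) * ∫ D, Real.exp (t * F D)
            ∂(Measure.pi fun _ => P) := integral_const_mul _ _
      _ ≤ Real.exp ((c / 2) ^ 2 * t ^ 2 / 2) * Real.exp (t * ∫ D, F D ∂(Measure.pi fun _ => P)
            + n * ((c / 2) ^ 2 * t ^ 2 / 2)) :=
          mul_le_mul_of_nonneg_left (ih F hFmeas hFM hFc) (Real.exp_pos _).le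
      _ = _ := by
          rw [← Real.exp_add]; push_cast; ring_nf

/-- McDiarmid's inequality. -/
theorem measure_boundedDifferences_le {P : Measure Z} [IsProbabilityMeasure P] {n : ℕ}
    (hn : 0 < n) {w M : ℝ} (hw : 0 < w) (f : (Fin n → Z) → ℝ) (hf : Measurable f)
    (hM : ∀ D, |f D| ≤ M) (hc : ∀ i D z, f (Function.update D i z) - f D ≤ w / n)
    {m : ℝ} (hm : ∫ D, f D ∂(Measure.pi fun _ => P) ≤ m) {δ : ℝ} (hδ : δ ∈ Ioo (0 : ℝ) 1) :
    1 - ENNReal.ofReal δ ≤ (Measure.pi fun _ : Fin n => P)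
      {D | f D ≤ m + w * √(Real.log (1 / δ) / (2 * n))} := by
  set s := w * √(Real.log (1 / δ) / (2 * n)) with hs
  have hn' : (0 : ℝ) < n := by exact_mod_cast hn
  have hlog : 0 ≤ Real.log (1 / δ) := Real.log_nonneg (by
    rw [le_div_iff₀ hδ.1]; linarith [hδ.2])
  have hs0 : 0 ≤ s := by positivity
  have hs2 : s ^ 2 = w ^ 2 * (Real.log (1 / δ) / (2 * n)) := by
    rw [hs, mul_pow, Real.sq_sqrt (by positivity)]
  -- This `t` minimises the Chernoff exponent `-t s + w² t² / (8 n)`, with minimum `-2 n s² / w²`.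
  set t := 4 * n * s / w ^ 2 with ht
  have ht0 : 0 ≤ t := by positivity
  have hmgf := integral_exp_le_of_boundedDifferences (P := P) t n f hf hM hc
  have hexp : Integrable (fun D => Real.exp (t * f D)) (Measure.pi fun _ : Fin n => P) := by
    refine integrable_of_abs_le (by fun_prop) (M := Real.exp (|t| * M)) fun D => ?_
    rw [abs_of_pos (Real.exp_pos _), Real.exp_le_exp]
    calc t * f D ≤ |t * f D| := le_abs_self _
      _ = |t| * |f D| := abs_mul _ _
      _ ≤ |t| * M := mul_le_mul_of_nonneg_left (hM D) (abs_nonneg t)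
  have htail := ProbabilityTheory.measure_ge_le_exp_mul_mgf (m + s) ht0 hexp
  have hle : (Measure.pi fun _ : Fin n => P).real {D | m + s ≤ f D} ≤ δ := by
    refine htail.trans ?_
    rw [ProbabilityTheory.mgf]
    calc _ ≤ Real.exp (-t * (m + s)) * Real.exp (t * m + n * ((w / n / 2) ^ 2 * t ^ 2 / 2)) := by
          refine mul_le_mul_of_nonneg_left (hmgf.trans ?_) (Real.exp_pos _).le
          rw [Real.exp_le_exp]
          gcongr
      _ = Real.exp (-(Real.log (1 / δ))) := by
          rw [← Real.exp_add]
          congr 1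
          have : -t * (m + s) + (t * m + n * ((w / n / 2) ^ 2 * t ^ 2 / 2))
              = - (2 * n * s ^ 2 / w ^ 2) := by
            rw [ht]; field_simp; ring
          rw [this, hs2]
          field_simp
      _ = δ := by
          rw [one_div, Real.log_inv, neg_neg, Real.exp_log hδ.1]
  have hmeas : MeasurableSet {D | f D ≤ m + s} := measurableSet_le hf measurable_const
  have hcompl : (Measure.pi fun _ : Fin n => P) {D | f D ≤ m + s}ᶜ ≤ ENNReal.ofReal δ := by
    rw [← ofReal_measureReal]
    refine ENNReal.ofReal_le_ofReal (le_trans (measureReal_mono ?_) hle)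
    intro D hD
    simp only [mem_compl_iff, mem_ofPred_eq, not_le] at hD ⊢
    exact hD.le
  have := prob_compl_eq_one_sub (μ := Measure.pi fun _ : Fin n => P) hmeas.compl
  rw [compl_compl] at this
  rw [this]
  exact tsub_le_tsub_left hcompl 1

end BoundedDifferences


/-! ### Rademacher averages over the discrete cube -/

section Rademacher

/-- The sign `1` or `-1` encoded by a boolean. -/
noncomputable def sgn (b : Bool) : ℝ := if b then 1 else -1

/-- The mean of a function of `n` independent uniform booleans. -/
noncomputable def cubeMean (n : ℕ) (g : (Fin n → Bool) → ℝ) : ℝ := ((2 : ℝ) ^ n)⁻¹ * ∑ σ, g σ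

theorem cubeMean_zero (g : (Fin 0 → Bool) → ℝ) : cubeMean 0 g = g ![] := by
  simp [cubeMean, Matrix.empty_eq]

theorem cubeMean_succ {n : ℕ} (g : (Fin (n + 1) → Bool) → ℝ) :
    cubeMean (n + 1) g
      = cubeMean n fun σ => (g (Fin.cons true σ) + g (Fin.cons false σ)) / 2 := by
  unfold cubeMean
  rw [← (Fin.consEquiv fun _ : Fin (n + 1) => Bool).sum_comp g, Fintype.sum_prod_type,
    Fintype.sum_bool, ← Finset.sum_div, Finset.sum_add_distrib]
  simp only [Fin.consEquiv, Equiv.coe_fn_mk]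
  rw [pow_succ]
  field_simp

theorem cubeMean_mono {n : ℕ} {g g' : (Fin n → Bool) → ℝ} (h : ∀ σ, g σ ≤ g' σ) :
    cubeMean n g ≤ cubeMean n g' :=
  mul_le_mul_of_nonneg_left (Finset.sum_le_sum fun σ _ => h σ) (by positivity)

theorem cubeMean_add {n : ℕ} (g g' : (Fin n → Bool) → ℝ) :
    cubeMean n (fun σ => g σ + g' σ) = cubeMean n g + cubeMean n g' := by
  simp only [cubeMean, Finset.sum_add_distrib, mul_add]

theorem cubeMean_const_mul {n : ℕ} (c : ℝ) (g : (Fin n → Bool) → ℝ) :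
    cubeMean n (fun σ => c * g σ) = c * cubeMean n g := by
  simp only [cubeMean, ← Finset.mul_sum]; ring

theorem cubeMean_const {n : ℕ} (c : ℝ) : cubeMean n (fun _ => c) = c := by
  simp [cubeMean]

theorem cubeMean_sq_le {n : ℕ} (g : (Fin n → Bool) → ℝ) :
    cubeMean n g ^ 2 ≤ cubeMean n fun σ => g σ ^ 2 := by
  have h := sq_sum_le_card_mul_sum_sq (s := (Finset.univ : Finset (Fin n → Bool))) (f := g)
  simp only [Finset.card_univ, Fintype.card_pi, Fintype.card_bool, Finset.prod_const,
    Fintype.card_fin, Nat.cast_pow, Nat.cast_ofNat] at h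
  unfold cubeMean
  rw [mul_pow]
  calc _ ≤ (((2 : ℝ) ^ n)⁻¹) ^ 2 * (2 ^ n * ∑ σ, g σ ^ 2) :=
        mul_le_mul_of_nonneg_left h (by positivity)
    _ = _ := by field_simp

/-- A real function which is bounded in absolute value. -/
def AbsBounded {ι : Type*} (f : ι → ℝ) : Prop := ∃ M, ∀ i, |f i| ≤ M

namespace AbsBounded

variable {ι : Type*} {f g : ι → ℝ}

theorem bddAbove (hf : AbsBounded f) : BddAbove (range f) := by
  obtain ⟨M, hM⟩ := hf
  exact ⟨M, by rintro _ ⟨i, rfl⟩; exact (le_abs_self _).trans (hM i)⟩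

theorem add (hf : AbsBounded f) (hg : AbsBounded g) : AbsBounded fun i => f i + g i := by
  obtain ⟨M, hM⟩ := hf
  obtain ⟨N, hN⟩ := hg
  exact ⟨M + N, fun i => (abs_add_le _ _).trans (add_le_add (hM i) (hN i))⟩

theorem const_mul (hf : AbsBounded f) (c : ℝ) : AbsBounded fun i => c * f i := by
  obtain ⟨M, hM⟩ := hf
  exact ⟨|c| * M, fun i => by
    rw [abs_mul]; exact mul_le_mul_of_nonneg_left (hM i) (abs_nonneg c)⟩

theorem sub (hf : AbsBounded f) (hg : AbsBounded g) : AbsBounded fun i => f i - g i := by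
  simpa [sub_eq_add_neg] using hf.add (hg.const_mul (-1))

theorem sum {κ : Type*} (s : Finset κ) {F : κ → ι → ℝ} (hF : ∀ k, AbsBounded (F k)) :
    AbsBounded fun i => ∑ k ∈ s, F k i := by
  classical
  induction s using Finset.induction_on with
  | empty => exact ⟨0, by simp⟩
  | insert k s hk ih =>
    simp only [Finset.sum_insert hk]
    exact (hF k).add ih

theorem lipschitz_comp (hf : AbsBounded f) {φ : ℝ → ℝ} {L : ℝ≥0} (hφ : LipschitzWith L φ) :
    AbsBounded fun i => φ (f i) := by
  obtain ⟨M, hM⟩ := hf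
  refine ⟨|φ 0| + L * M, fun i => ?_⟩
  have h := hφ.dist_le_mul (f i) 0
  rw [Real.dist_eq, Real.dist_eq, sub_zero] at h
  have h1 : |φ (f i)| ≤ |φ 0| + |φ (f i) - φ 0| := by
    have := abs_add_le (φ 0) (φ (f i) - φ 0)
    simpa using this
  have h2 : (L : ℝ) * |f i| ≤ L * M := mul_le_mul_of_nonneg_left (hM i) L.coe_nonneg
  linarith

end AbsBounded

variable {ι : Type*} [Nonempty ι]

/-- The two suprema on the left may be tested at separate points `i` and `j`, where `φ (u i) - φ (u
j) ≤ L |u i - u j|`. The sign of `u i - u j` decides which point is used in which supremum on the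
right. -/
theorem iSup_add_iSup_contraction_le {a u : ι → ℝ} (ha : AbsBounded a) (hu : AbsBounded u)
    {φ : ℝ → ℝ} {L : ℝ≥0} (hφ : LipschitzWith L φ) :
    (⨆ i, (a i + φ (u i))) + (⨆ i, (a i - φ (u i)))
      ≤ (⨆ i, (a i + L * u i)) + (⨆ i, (a i - L * u i)) := by
  have h1 := (ha.add (hu.const_mul L)).bddAbove
  have h2 := (ha.sub (hu.const_mul L)).bddAbove
  refine ciSup_add_ciSup_le fun i j => ?_
  have h := hφ.dist_le_mul (u i) (u j)
  rw [Real.dist_eq, Real.dist_eq] at h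
  have h' := (le_abs_self _).trans h
  rcases le_total (u j) (u i) with hij | hij
  · rw [abs_of_nonneg (sub_nonneg.2 hij)] at h'
    have := le_ciSup h1 i
    have := le_ciSup h2 j
    linarith
  · rw [abs_of_nonpos (sub_nonpos.2 hij)] at h'
    have := le_ciSup h1 j
    have := le_ciSup h2 i
    linarith

/-- Talagrand's contraction principle. -/
theorem cubeMean_iSup_contraction_le {L : ℝ≥0} : ∀ (n : ℕ) (a : ι → ℝ) (u : Fin n → ι → ℝ)
    (φ : Fin n → ℝ → ℝ), AbsBounded a → (∀ k, AbsBounded (u k)) → (∀ k, LipschitzWith L (φ k)) →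
    cubeMean n (fun σ => ⨆ i, (a i + ∑ k, sgn (σ k) * φ k (u k i)))
      ≤ cubeMean n (fun σ => ⨆ i, (a i + ∑ k, sgn (σ k) * (L * u k i))) := by
  intro n
  induction n with
  | zero => intro a u φ _ _ _; simp [cubeMean_zero]
  | succ n ih =>
    intro a u φ ha hu hφ
    rw [cubeMean_succ, cubeMean_succ]
    have hsum : ∀ σ : Fin n → Bool,
        AbsBounded fun i => ∑ k, sgn (σ k) * φ k.succ (u k.succ i) := fun σ =>
      AbsBounded.sum _ fun k => ((hu k.succ).lipschitz_comp (hφ k.succ)).const_mul _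
    -- With the other signs frozen, averaging over the first sign replaces `φ 0` by multiplication
    -- by `L`. The resulting term `± L * u 0 i` joins the offset `a`, which is why the induction
    -- runs over all offsets.
    have step : ∀ σ : Fin n → Bool,
        ((⨆ i, (a i + ∑ k, sgn ((Fin.cons true σ : Fin (n + 1) → Bool) k) * φ k (u k i)))
          + ⨆ i, (a i + ∑ k, sgn ((Fin.cons false σ : Fin (n + 1) → Bool) k) * φ k (u k i))) / 2
        ≤ ((1 / 2) * ⨆ i, ((a i + L * u 0 i) + ∑ k, sgn (σ k) * φ k.succ (u k.succ i)))
          + (1 / 2) * ⨆ i, ((a i - L * u 0 i) + ∑ k, sgn (σ k) * φ k.succ (u k.succ i)) := by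
      intro σ
      have h := iSup_add_iSup_contraction_le (ha.add (hsum σ)) (hu 0) (hφ 0)
      have e1 : ∀ i, a i + ∑ k, sgn ((Fin.cons true σ : Fin (n + 1) → Bool) k) * φ k (u k i)
          = a i + ∑ k, sgn (σ k) * φ k.succ (u k.succ i) + φ 0 (u 0 i) := fun i => by
        rw [Fin.sum_univ_succ]; simp [sgn]; ring
      have e2 : ∀ i, a i + ∑ k, sgn ((Fin.cons false σ : Fin (n + 1) → Bool) k) * φ k (u k i)
          = a i + ∑ k, sgn (σ k) * φ k.succ (u k.succ i) - φ 0 (u 0 i) := fun i => by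
        rw [Fin.sum_univ_succ]; simp [sgn]; ring
      have e3 : ∀ i, (a i + L * u 0 i) + ∑ k, sgn (σ k) * φ k.succ (u k.succ i)
          = a i + ∑ k, sgn (σ k) * φ k.succ (u k.succ i) + L * u 0 i := fun i => by ring
      have e4 : ∀ i, (a i - L * u 0 i) + ∑ k, sgn (σ k) * φ k.succ (u k.succ i)
          = a i + ∑ k, sgn (σ k) * φ k.succ (u k.succ i) - L * u 0 i := fun i => by ring
      simp_rw [e1, e2, e3, e4]
      linarith
    refine (cubeMean_mono step).trans ?_
    rw [cubeMean_add, cubeMean_const_mul, cubeMean_const_mul]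
    have h1 := ih (fun i => a i + L * u 0 i) (fun k => u k.succ) (fun k => φ k.succ)
      (ha.add ((hu 0).const_mul L)) (fun k => hu k.succ) (fun k => hφ k.succ)
    have h2 := ih (fun i => a i - L * u 0 i) (fun k => u k.succ) (fun k => φ k.succ)
      (ha.sub ((hu 0).const_mul L)) (fun k => hu k.succ) (fun k => hφ k.succ)
    refine (add_le_add (mul_le_mul_of_nonneg_left h1 (by norm_num))
      (mul_le_mul_of_nonneg_left h2 (by norm_num))).trans (le_of_eq ?_)
    rw [← cubeMean_const_mul, ← cubeMean_const_mul, ← cubeMean_add]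
    congr 1
    ext σ
    have e1 : ∀ i, a i + ∑ k, sgn ((Fin.cons true σ : Fin (n + 1) → Bool) k) * (L * u k i)
        = a i + L * u 0 i + ∑ k, sgn (σ k) * (L * u k.succ i) := fun i => by
      rw [Fin.sum_univ_succ]; simp [sgn]; ring
    have e2 : ∀ i, a i + ∑ k, sgn ((Fin.cons false σ : Fin (n + 1) → Bool) k) * (L * u k i)
        = a i - L * u 0 i + ∑ k, sgn (σ k) * (L * u k.succ i) := fun i => by
      rw [Fin.sum_univ_succ]; simp [sgn]; ring
    simp_rw [e1, e2]
    ring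

variable {H : Type*} [NormedAddCommGroup H] [InnerProductSpace ℝ H]

/-- Independent signs make the vectors orthogonal in mean: the parallelogram law removes the cross
terms of one vector at a time. -/
theorem cubeMean_norm_sq : ∀ (n : ℕ) (w : H) (v : Fin n → H),
    cubeMean n (fun σ => ‖w + ∑ k, sgn (σ k) • v k‖ ^ 2) = ‖w‖ ^ 2 + ∑ k, ‖v k‖ ^ 2 := by
  intro n
  induction n with
  | zero => intro w v; simp [cubeMean_zero]
  | succ n ih =>
    intro w v
    rw [cubeMean_succ]
    have step : ∀ σ : Fin n → Bool,
        (‖w + ∑ k, sgn ((Fin.cons true σ : Fin (n + 1) → Bool) k) • v k‖ ^ 2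
          + ‖w + ∑ k, sgn ((Fin.cons false σ : Fin (n + 1) → Bool) k) • v k‖ ^ 2) / 2
        = ‖w + ∑ k, sgn (σ k) • v k.succ‖ ^ 2 + ‖v 0‖ ^ 2 := by
      intro σ
      have e1 : w + ∑ k, sgn ((Fin.cons true σ : Fin (n + 1) → Bool) k) • v k
          = (w + ∑ k, sgn (σ k) • v k.succ) + v 0 := by
        rw [Fin.sum_univ_succ]; simp [sgn]; abel
      have e2 : w + ∑ k, sgn ((Fin.cons false σ : Fin (n + 1) → Bool) k) • v k
          = (w + ∑ k, sgn (σ k) • v k.succ) - v 0 := by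
        rw [Fin.sum_univ_succ]; simp [sgn]; abel
      rw [e1, e2]
      have := parallelogram_law_with_norm ℝ (w + ∑ k, sgn (σ k) • v k.succ) (v 0)
      nlinarith
    simp_rw [step]
    rw [cubeMean_add, ih, cubeMean_const, Fin.sum_univ_succ]
    ring

theorem cubeMean_norm_le {n : ℕ} {v : Fin n → H} {κ : ℝ} (hv : ∀ k, ‖v k‖ ^ 2 ≤ κ) :
    cubeMean n (fun σ => ‖∑ k, sgn (σ k) • v k‖) ≤ √(n * κ) := by
  refine Real.le_sqrt_of_sq_le ((cubeMean_sq_le _).trans ?_)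
  have h := cubeMean_norm_sq n 0 v
  simp only [zero_add] at h
  rw [h]
  calc ‖(0 : H)‖ ^ 2 + ∑ k, ‖v k‖ ^ 2 ≤ 0 + ∑ _k : Fin n, κ := by
        gcongr with k
        · simp
        · exact hv k
    _ = n * κ := by simp

instance : Nonempty {f : H // ‖f‖ ≤ 1} := ⟨⟨0, by simp⟩⟩

theorem absBounded_inner (v : H) : AbsBounded fun f : {f : H // ‖f‖ ≤ 1} => inner ℝ (f : H) v :=
  ⟨‖v‖, fun f => (abs_real_inner_le_norm _ _).trans
    (mul_le_of_le_one_left (norm_nonneg v) f.2)⟩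

/-- The Rademacher complexity of Lipschitz functions of the unit ball of a Hilbert space. -/
theorem cubeMean_iSup_ball_le {n : ℕ} {v : Fin n → H} {κ : ℝ} (hv : ∀ k, ‖v k‖ ^ 2 ≤ κ)
    {φ : Fin n → ℝ → ℝ} {L : ℝ≥0} (hφ : ∀ k, LipschitzWith L (φ k)) :
    cubeMean n (fun σ => ⨆ f : {f : H // ‖f‖ ≤ 1}, ∑ k, sgn (σ k) * φ k (inner ℝ (f : H) (v k)))
      ≤ L * √(n * κ) := by
  have h := cubeMean_iSup_contraction_le n (fun _ : {f : H // ‖f‖ ≤ 1} => 0)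
    (fun k f => inner ℝ (f : H) (v k)) φ ⟨0, by simp⟩ (fun k => absBounded_inner (v k)) hφ
  simp only [zero_add] at h
  refine h.trans ?_
  refine le_trans (cubeMean_mono (g' := fun σ => L * ‖∑ k, sgn (σ k) • v k‖) fun σ => ?_) ?_
  · refine ciSup_le fun f => ?_
    have e : ∑ k, sgn (σ k) * (L * inner ℝ (f : H) (v k))
        = L * inner ℝ (f : H) (∑ k, sgn (σ k) • v k) := by
      rw [inner_sum, Finset.mul_sum]
      refine Finset.sum_congr rfl fun k _ => ?_
      rw [real_inner_smul_right]; ring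
    rw [e]
    refine mul_le_mul_of_nonneg_left ((real_inner_le_norm _ _).trans ?_) L.coe_nonneg
    exact mul_le_of_le_one_left (norm_nonneg _) f.2
  · rw [cubeMean_const_mul]
    exact mul_le_mul_of_nonneg_left (cubeMean_norm_le hv) L.coe_nonneg

end Rademacher


/-! ### Uniform deviation over the unit ball: ghost sample, measurability, symmetrisation -/

section UniformDeviation

variable {Z : Type*} {H : Type*} [NormedAddCommGroup H]
  [InnerProductSpace ℝ H]

/-- The difference of the empirical risks of `f` on the samples `D'` and `D`. -/
noncomputable def empGap (ξ : Z → H) (φ : Z → ℝ → ℝ) {n : ℕ} (D D' : Fin n → Z) (f : H) : ℝ :=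
  (1 / (n : ℝ)) * ∑ k, (φ (D' k) (inner ℝ f (ξ (D' k))) - φ (D k) (inner ℝ f (ξ (D k))))

/-- The supremum of `empGap` over the unit ball. -/
@[irreducible]
noncomputable def supGap (ξ : Z → H) (φ : Z → ℝ → ℝ) {n : ℕ} (D D' : Fin n → Z) : ℝ :=
  ⨆ f : {f : H // ‖f‖ ≤ 1}, empGap ξ φ D D' f

variable {ξ : Z → H} {φ : Z → ℝ → ℝ} {a w : ℝ} {n : ℕ}

theorem abs_empGap_le (hn : 0 < n) (hφ : ∀ z t, φ z t ∈ Icc a (a + w)) (D D' : Fin n → Z)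
    (f : H) : |empGap ξ φ D D' f| ≤ w := by
  have hn' : (0 : ℝ) < n := by exact_mod_cast hn
  unfold empGap
  rw [abs_mul, abs_of_pos (by positivity), one_div, inv_mul_le_iff₀ hn']
  refine (Finset.abs_sum_le_sum_abs _ _).trans ?_
  refine (Finset.sum_le_sum (g := fun _ => w) fun k _ => ?_).trans (by simp)
  have h1 := hφ (D' k) (inner ℝ f (ξ (D' k)))
  have h2 := hφ (D k) (inner ℝ f (ξ (D k)))
  rw [abs_le]
  constructor <;> linarith [h1.1, h1.2, h2.1, h2.2]

theorem bddAbove_empGap (hn : 0 < n) (hφ : ∀ z t, φ z t ∈ Icc a (a + w)) (D D' : Fin n → Z) :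
    BddAbove (range fun f : {f : H // ‖f‖ ≤ 1} => empGap ξ φ D D' f) :=
  ⟨w, by rintro _ ⟨f, rfl⟩; exact (le_abs_self _).trans (abs_empGap_le hn hφ D D' _)⟩

theorem empGap_le_supGap (hn : 0 < n) (hφ : ∀ z t, φ z t ∈ Icc a (a + w)) (D D' : Fin n → Z)
    {f : H} (hf : ‖f‖ ≤ 1) : empGap ξ φ D D' f ≤ supGap ξ φ D D' := by
  unfold supGap
  exact le_ciSup (bddAbove_empGap (ξ := ξ) hn hφ D D') ⟨f, hf⟩

theorem supGap_le {D D' : Fin n → Z} {c : ℝ} (h : ∀ f : H, ‖f‖ ≤ 1 → empGap ξ φ D D' f ≤ c) :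
    supGap ξ φ D D' ≤ c := by
  unfold supGap
  exact ciSup_le fun f => h f f.2

theorem abs_supGap_le (hn : 0 < n) (hφ : ∀ z t, φ z t ∈ Icc a (a + w)) (D D' : Fin n → Z) :
    |supGap ξ φ D D'| ≤ w := by
  rw [abs_le]
  constructor
  · exact (abs_le.1 (abs_empGap_le hn hφ D D' (0 : H))).1.trans
      (empGap_le_supGap hn hφ D D' (by simp))
  · exact supGap_le fun f _ => (le_abs_self _).trans (abs_empGap_le hn hφ D D' _)

theorem supGap_update_sub_le (hn : 0 < n) (hφ : ∀ z t, φ z t ∈ Icc a (a + w))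
    (D D' : Fin n → Z) (i : Fin n) (z : Z) :
    supGap ξ φ (Function.update D i z) D' - supGap ξ φ D D' ≤ w / n := by
  rw [sub_le_iff_le_add]
  refine supGap_le fun f hf => ?_
  have h := empGap_le_supGap (ξ := ξ) hn hφ D D' hf
  refine le_trans ?_ (add_le_add_right h _)
  have hn' : (0 : ℝ) < n := by exact_mod_cast hn
  rw [← sub_le_iff_le_add]
  unfold empGap
  rw [← mul_sub, ← Finset.sum_sub_distrib, Finset.sum_eq_single i]
  · have h1 := hφ z (inner ℝ (f : H) (ξ z))
    have h2 := hφ (D i) (inner ℝ (f : H) (ξ (D i)))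
    rw [Function.update_self, one_div, div_eq_inv_mul]
    refine mul_le_mul_of_nonneg_left ?_ (by positivity)
    linarith [h1.1, h1.2, h2.1, h2.2]
  · intro k _ hk
    rw [Function.update_of_ne hk]; ring
  · simp

/-- The radial retraction of a Hilbert space onto its unit ball. -/
noncomputable def shrink (f : H) : H := (max 1 ‖f‖)⁻¹ • f

theorem norm_shrink_le (f : H) : ‖shrink f‖ ≤ 1 := by
  have h : (0 : ℝ) < max 1 ‖f‖ := lt_max_of_lt_left one_pos
  rw [shrink, norm_smul, norm_inv, Real.norm_of_nonneg h.le, inv_mul_le_iff₀ h, mul_one]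
  exact le_max_right _ _

theorem shrink_of_norm_le {f : H} (hf : ‖f‖ ≤ 1) : shrink f = f := by
  simp [shrink, max_eq_left hf]

theorem continuous_shrink : Continuous (shrink : H → H) := by
  unfold shrink
  refine Continuous.smul (Continuous.inv₀ (by fun_prop) fun f => ?_) continuous_id
  exact (lt_max_of_lt_left one_pos).ne'

/-- The feature vectors of a pair of samples, combined with coefficients `α`. -/
noncomputable def featureComb (ξ : Z → H) (D D' : Fin n → Z) (α : Fin n ⊕ Fin n → ℝ) : H :=
  ∑ j, α j • ξ (Sum.elim D D' j)

/-- This makes the supremum countable without separability of `H`. The gap sees `f` only through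
inner products with the `2 n` feature vectors, so `f` can be projected onto their span. There
rational coefficients suffice by density, and `shrink` keeps every combination inside the ball. -/
theorem supGap_eq_iSup_rat {L : ℝ≥0} (hn : 0 < n)
    (hφ : ∀ z t, φ z t ∈ Icc a (a + w)) (hL : ∀ z, LipschitzWith L (φ z)) (D D' : Fin n → Z) :
    supGap ξ φ D D' = ⨆ α : Fin n ⊕ Fin n → ℚ,
      empGap ξ φ D D' (shrink (featureComb ξ D D' fun j => (α j : ℝ))) := by
  have hbdd : BddAbove (range fun α : Fin n ⊕ Fin n → ℚ =>
      empGap ξ φ D D' (shrink (featureComb ξ D D' fun j => (α j : ℝ)))) :=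
    ⟨w, by rintro _ ⟨f, rfl⟩; exact (le_abs_self _).trans (abs_empGap_le hn hφ D D' _)⟩
  apply le_antisymm
  · refine supGap_le fun f hf => ?_
    set V := Submodule.span ℝ (range fun j => ξ (Sum.elim D D' j)) with hV
    have : FiniteDimensional ℝ V := FiniteDimensional.span_of_finite ℝ (finite_range _)
    have hproj : V.starProjection (f : H) ∈ V := V.starProjection_apply_mem _
    obtain ⟨β, hβ⟩ := (Submodule.mem_span_range_iff_exists_fun ℝ).1 hproj
    have hnorm : ‖V.starProjection (f : H)‖ ≤ 1 :=
      (V.norm_starProjection_apply_le _).trans hf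
    have hinner : ∀ j, inner ℝ (f : H) (ξ (Sum.elim D D' j))
        = inner ℝ (V.starProjection (f : H)) (ξ (Sum.elim D D' j)) := by
      intro j
      have hmem : ξ (Sum.elim D D' j) ∈ V := Submodule.subset_span ⟨j, rfl⟩
      rw [V.inner_starProjection_left_eq_right, V.starProjection_eq_self_iff.2 hmem]
    have heq : empGap ξ φ D D' f = empGap ξ φ D D' (shrink (featureComb ξ D D' β)) := by
      have : featureComb ξ D D' β = V.starProjection (f : H) := hβ
      rw [this, shrink_of_norm_le hnorm]
      unfold empGap
      congr 1
      refine Finset.sum_congr rfl fun k _ => ?_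
      have h1 := hinner (Sum.inl k)
      have h2 := hinner (Sum.inr k)
      simp only [Sum.elim_inl, Sum.elim_inr] at h1 h2
      rw [h1, h2]
    rw [heq]
    have hcont : Continuous fun α : Fin n ⊕ Fin n → ℝ =>
        empGap ξ φ D D' (shrink (featureComb ξ D D' α)) := by
      have hc : Continuous fun α : Fin n ⊕ Fin n → ℝ => shrink (featureComb ξ D D' α) :=
        continuous_shrink.comp (by unfold featureComb; fun_prop)
      unfold empGap
      refine continuous_const.mul (continuous_finsetSum _ fun k _ => ?_)
      exact ((hL _).continuous.comp (hc.inner continuous_const)).sub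
        ((hL _).continuous.comp (hc.inner continuous_const))
    have hdense : DenseRange (fun (α : Fin n ⊕ Fin n → ℚ) (j : Fin n ⊕ Fin n) => (α j : ℝ)) :=
      DenseRange.piMap fun _ => Rat.denseRange_cast
    exact hdense.induction_on β (isClosed_le hcont continuous_const) fun α => le_ciSup hbdd α
  · exact ciSup_le fun α => empGap_le_supGap hn hφ D D' (norm_shrink_le _)

/-- The pair of samples obtained from a sample of pairs by swapping the `k`-th pair unless
`σ k`. -/
def signSwap {Z : Type*} {n : ℕ} (σ : Fin n → Bool) (W : Fin n → Z × Z) : Fin n → Z × Z :=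
  fun k => if σ k then W k else (W k).swap

/-- Swapping a pair flips the sign of its summand. Splitting the supremum of a difference into two
suprema leaves two Rademacher averages, each at most `L * √(κ / n)`. -/
theorem cubeMean_supGap_signSwap_le {L : ℝ≥0} {κ : ℝ} (hn : 0 < n)
    (hκ : ∀ z, ‖ξ z‖ ^ 2 ≤ κ) (hL : ∀ z, LipschitzWith L (φ z)) (W : Fin n → Z × Z) :
    cubeMean n (fun σ => supGap ξ φ (fun k => (signSwap σ W k).1) fun k => (signSwap σ W k).2)
      ≤ 2 * L * √(κ / n) := by
  have hn' : (0 : ℝ) < n := by exact_mod_cast hn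
  have hb : ∀ (σ : Fin n → Bool) (ψ : Fin n → ℝ → ℝ) (v : Fin n → H),
      (∀ k, LipschitzWith L (ψ k)) →
      BddAbove (range fun f : {f : H // ‖f‖ ≤ 1} =>
        ∑ k, sgn (σ k) * ψ k (inner ℝ (f : H) (v k))) := fun σ ψ v hψ =>
    (AbsBounded.sum _ fun k => ((absBounded_inner (v k)).lipschitz_comp
      (hψ k)).const_mul _).bddAbove
  have hneg : ∀ z, LipschitzWith L fun t => -φ z t := fun z => (hL z).neg
  have step : ∀ σ : Fin n → Bool,
      supGap ξ φ (fun k => (signSwap σ W k).1) (fun k => (signSwap σ W k).2)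
      ≤ (1 / (n : ℝ)) * (⨆ f : {f : H // ‖f‖ ≤ 1},
            ∑ k, sgn (σ k) * φ (W k).2 (inner ℝ (f : H) (ξ (W k).2)))
        + (1 / (n : ℝ)) * ⨆ f : {f : H // ‖f‖ ≤ 1},
            ∑ k, sgn (σ k) * (-φ (W k).1 (inner ℝ (f : H) (ξ (W k).1))) := by
    intro σ
    refine supGap_le fun f hf => ?_
    have h1 := le_ciSup (hb σ (fun k => φ (W k).2) (fun k => ξ (W k).2) fun k => hL _) ⟨f, hf⟩
    have h2 := le_ciSup (hb σ (fun k t => -φ (W k).1 t) (fun k => ξ (W k).1) fun k => hneg _)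
      ⟨f, hf⟩
    rw [← mul_add]
    unfold empGap
    refine mul_le_mul_of_nonneg_left (le_trans (le_of_eq ?_) (add_le_add h1 h2)) (by positivity)
    rw [← Finset.sum_add_distrib]
    refine Finset.sum_congr rfl fun k _ => ?_
    rcases hσ : σ k <;> simp [signSwap, sgn, hσ] <;> ring
  refine (cubeMean_mono step).trans ?_
  rw [cubeMean_add, cubeMean_const_mul, cubeMean_const_mul]
  have h1 := cubeMean_iSup_ball_le (v := fun k => ξ (W k).2) (fun k => hκ _)
    (φ := fun k => φ (W k).2) fun k => hL _
  have h2 := cubeMean_iSup_ball_le (v := fun k => ξ (W k).1) (fun k => hκ _)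
    (φ := fun k t => -φ (W k).1 t) fun k => hneg _
  refine (add_le_add (mul_le_mul_of_nonneg_left h1 (by positivity))
    (mul_le_mul_of_nonneg_left h2 (by positivity))).trans (le_of_eq ?_)
  have : √(κ / n) = 1 / n * √(n * κ) := by
    rw [show κ / n = (n * κ) / (n : ℝ) ^ 2 by field_simp, Real.sqrt_div' _ (by positivity),
      Real.sqrt_sq hn'.le]
    ring
  rw [this]; ring

variable [MeasurableSpace Z]

/-- The inner products entering the countable supremum are built from those of pairs of feature
vectors, so measurability of the kernel is enough and `ξ` itself need not be measurable. -/
theorem measurable_supGap {L : ℝ≥0} (hn : 0 < n)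
    (hξ : Measurable fun p : Z × Z => inner ℝ (ξ p.1) (ξ p.2))
    (hφm : Measurable (Function.uncurry φ))
    (hφ : ∀ z t, φ z t ∈ Icc a (a + w)) (hL : ∀ z, LipschitzWith L (φ z)) :
    Measurable fun p : (Fin n → Z) × (Fin n → Z) => supGap ξ φ p.1 p.2 := by
  simp_rw [supGap_eq_iSup_rat hn hφ hL]
  refine Measurable.iSup fun α => ?_
  have hpt : ∀ j : Fin n ⊕ Fin n,
      Measurable fun p : (Fin n → Z) × (Fin n → Z) => (Sum.elim p.1 p.2 j : Z) := by
    rintro (j | j)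
    · exact (measurable_pi_apply j).comp measurable_fst
    · exact (measurable_pi_apply j).comp measurable_snd
  have hcomb : ∀ j : Fin n ⊕ Fin n, Measurable fun p : (Fin n → Z) × (Fin n → Z) =>
      inner ℝ (featureComb ξ p.1 p.2 fun j => (α j : ℝ)) (ξ (Sum.elim p.1 p.2 j)) := by
    intro j
    simp_rw [featureComb, sum_inner, real_inner_smul_left]
    exact Finset.measurable_sum _ fun i _ =>
      (hξ.comp ((hpt i).prodMk (hpt j))).const_mul _
  have hnorm : Measurable fun p : (Fin n → Z) × (Fin n → Z) =>
      ‖featureComb ξ p.1 p.2 fun j => (α j : ℝ)‖ := by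
    have : ∀ p : (Fin n → Z) × (Fin n → Z), ‖featureComb ξ p.1 p.2 fun j => (α j : ℝ)‖
        = √(∑ j, (α j : ℝ) *
          inner ℝ (featureComb ξ p.1 p.2 fun j => (α j : ℝ)) (ξ (Sum.elim p.1 p.2 j))) := by
      intro p
      rw [norm_eq_sqrt_real_inner]
      conv_lhs => rw [featureComb.eq_1 ξ p.1 p.2 (fun j => (α j : ℝ)), inner_sum]
      simp_rw [real_inner_smul_right]
      rfl
    simp_rw [this]
    exact (Finset.measurable_sum _ fun i _ => (hcomb i).const_mul _).sqrt
  have hval : ∀ j : Fin n ⊕ Fin n, Measurable fun p : (Fin n → Z) × (Fin n → Z) =>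
      φ (Sum.elim p.1 p.2 j) (inner ℝ (shrink (featureComb ξ p.1 p.2 fun j => (α j : ℝ)))
        (ξ (Sum.elim p.1 p.2 j))) := by
    intro j
    refine hφm.comp ((hpt j).prodMk ?_)
    simp_rw [shrink, real_inner_smul_left]
    exact ((measurable_const.max hnorm).inv).mul (hcomb j)
  unfold empGap
  exact (Finset.measurable_sum _ fun k _ => (hval (Sum.inr k)).sub (hval (Sum.inl k))).const_mul _

variable {P : Measure Z} [IsProbabilityMeasure P]

theorem measurePreserving_signSwap (σ : Fin n → Bool) :
    MeasurePreserving (signSwap σ) (Measure.pi fun _ : Fin n => P.prod P)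
      (Measure.pi fun _ : Fin n => P.prod P) := by
  refine measurePreserving_pi (f := fun k (q : Z × Z) => if σ k then q else q.swap) _ _ fun k => ?_
  rcases σ k
  · simpa using Measure.measurePreserving_swap
  · exact MeasurePreserving.id _

/-- The law of the sample of pairs is invariant under every swap, so the integrand may be replaced
by its mean over all swaps, which is bounded pointwise. -/
theorem integral_supGap_le {L : ℝ≥0} {κ : ℝ} (hn : 0 < n)
    (hξ : Measurable fun p : Z × Z => inner ℝ (ξ p.1) (ξ p.2)) (hκ : ∀ z, ‖ξ z‖ ^ 2 ≤ κ)
    (hφm : Measurable (Function.uncurry φ))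
    (hφ : ∀ z t, φ z t ∈ Icc a (a + w)) (hL : ∀ z, LipschitzWith L (φ z)) :
    ∫ p, supGap ξ φ p.1 p.2 ∂((Measure.pi fun _ : Fin n => P).prod (Measure.pi fun _ => P))
      ≤ 2 * L * √(κ / n) := by
  have hm := measurable_supGap (n := n) hn hξ hφm hφ hL
  have mp := measurePreserving_arrowProdEquivProdArrow Z Z (Fin n) (fun _ => P) (fun _ => P)
  set G : (Fin n → Z × Z) → ℝ := fun W => supGap ξ φ (fun k => (W k).1) fun k => (W k).2 with hG
  have hGm : Measurable G :=
    hm.comp (MeasurableEquiv.arrowProdEquivProdArrow Z Z (Fin n)).measurable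
  have e0 : ∫ p, supGap ξ φ p.1 p.2 ∂((Measure.pi fun _ : Fin n => P).prod (Measure.pi fun _ => P))
      = ∫ W, G W ∂(Measure.pi fun _ : Fin n => P.prod P) :=
    (mp.integral_comp' fun p => supGap ξ φ p.1 p.2).symm
  have hint : ∀ σ : Fin n → Bool, Integrable (fun W => G (signSwap σ W))
      (Measure.pi fun _ : Fin n => P.prod P) := fun σ =>
    integrable_of_abs_le (hGm.comp (measurePreserving_signSwap (P := P) σ).measurable)
      fun W => abs_supGap_le hn hφ _ _
  have e1 : ∀ σ : Fin n → Bool, ∫ W, G (signSwap σ W) ∂(Measure.pi fun _ : Fin n => P.prod P)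
      = ∫ W, G W ∂(Measure.pi fun _ : Fin n => P.prod P) := fun σ => by
    have h := measurePreserving_signSwap (P := P) σ
    rw [← integral_map h.measurable.aemeasurable (by rw [h.map_eq]; exact hGm.aestronglyMeasurable),
      h.map_eq]
  have hle : ∀ W, cubeMean n (fun σ => G (signSwap σ W)) ≤ 2 * L * √(κ / n) :=
    cubeMean_supGap_signSwap_le hn hκ hL
  have hintc : Integrable (fun W => cubeMean n fun σ => G (signSwap σ W))
      (Measure.pi fun _ : Fin n => P.prod P) :=
    (integrable_finsetSum _ fun σ _ => hint σ).const_mul _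
  rw [e0]
  calc ∫ W, G W ∂(Measure.pi fun _ : Fin n => P.prod P)
      = cubeMean n fun σ => ∫ W, G (signSwap σ W) ∂(Measure.pi fun _ : Fin n => P.prod P) := by
        simp_rw [e1]; rw [cubeMean_const]
    _ = ∫ W, cubeMean n (fun σ => G (signSwap σ W)) ∂(Measure.pi fun _ : Fin n => P.prod P) := by
        unfold cubeMean
        rw [integral_const_mul, integral_finsetSum _ fun σ _ => hint σ]
    _ ≤ ∫ _, 2 * L * √(κ / n) ∂(Measure.pi fun _ : Fin n => P.prod P) := by
        exact integral_mono hintc (integrable_const _) hle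
    _ = _ := by simp

/-- With high probability, the risk of every function of the unit ball is controlled by its
empirical risk. -/
theorem uniform_deviation {L : ℝ≥0} {κ : ℝ} (hn : 0 < n)
    (hξ : Measurable fun p : Z × Z => inner ℝ (ξ p.1) (ξ p.2)) (hκ : ∀ z, ‖ξ z‖ ^ 2 ≤ κ)
    (hξf : ∀ f : H, Measurable fun z => inner ℝ f (ξ z))
    (hφm : Measurable (Function.uncurry φ)) (hw : 0 < w)
    (hφ : ∀ z t, φ z t ∈ Icc a (a + w)) (hL : ∀ z, LipschitzWith L (φ z))
    {δ : ℝ} (hδ : δ ∈ Ioo (0 : ℝ) 1) :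
    ∃ A : Set (Fin n → Z), MeasurableSet A ∧
      1 - ENNReal.ofReal δ ≤ Measure.pi (fun _ : Fin n => P) A ∧
      ∀ D ∈ A, ∀ f : H, ‖f‖ ≤ 1 →
        ∫ z, φ z (inner ℝ f (ξ z)) ∂P ≤ (1 / (n : ℝ)) * ∑ k, φ (D k) (inner ℝ f (ξ (D k)))
          + 2 * L * √(κ / n) + w * √(Real.log (1 / δ) / (2 * n)) := by
  have hn' : (0 : ℝ) < n := by exact_mod_cast hn
  have hm := measurable_supGap (n := n) hn hξ hφm hφ hL
  have hslice : ∀ D : Fin n → Z, Integrable (fun D' => supGap ξ φ D D')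
      (Measure.pi fun _ : Fin n => P) := fun D =>
    integrable_of_abs_le (hm.comp (measurable_const.prodMk measurable_id))
      fun D' => abs_supGap_le hn hφ D D'
  -- `Φ` averages the supremum over a ghost sample. It dominates the risk deviation of each `f`, its
  -- measurability comes from that of `supGap`, and its mean is already symmetrised.
  set Φ : (Fin n → Z) → ℝ := fun D => ∫ D', supGap ξ φ D D' ∂(Measure.pi fun _ => P) with hΦ
  have hΦm : Measurable Φ := (hm.stronglyMeasurable.integral_prod_right').measurable
  have hΦM : ∀ D, |Φ D| ≤ w := fun D => by
    have := norm_integral_le_of_norm_le_const (μ := Measure.pi fun _ : Fin n => P)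
      (f := fun D' => supGap ξ φ D D') (C := w)
      (Filter.Eventually.of_forall fun D' => abs_supGap_le hn hφ D D')
    simpa using this
  have hΦc : ∀ i D z, Φ (Function.update D i z) - Φ D ≤ w / n := fun i D z => by
    rw [hΦ]
    dsimp only
    rw [← integral_sub (hslice _) (hslice _)]
    calc _ ≤ ∫ _, w / n ∂(Measure.pi fun _ : Fin n => P) :=
          integral_mono ((hslice _).sub (hslice _)) (integrable_const _)
            fun D' => supGap_update_sub_le hn hφ D D' i z
      _ = w / n := by simp
  have hΦmean : ∫ D, Φ D ∂(Measure.pi fun _ : Fin n => P) ≤ 2 * L * √(κ / n) := by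
    refine le_trans (le_of_eq ?_) (integral_supGap_le (P := P) (n := n) hn hξ hκ hφm hφ hL)
    exact (integral_prod (fun p : (Fin n → Z) × (Fin n → Z) => supGap ξ φ p.1 p.2)
      (integrable_of_abs_le hm fun p => abs_supGap_le hn hφ _ _)).symm
  refine ⟨{D | Φ D ≤ 2 * L * √(κ / n) + w * √(Real.log (1 / δ) / (2 * n))},
    measurableSet_le hΦm measurable_const,
    measure_boundedDifferences_le hn hw Φ hΦm hΦM hΦc hΦmean hδ, fun D hD f hf => ?_⟩
  have hφf : Measurable fun z => φ z (inner ℝ f (ξ z)) := hφm.comp (measurable_id.prodMk (hξf f))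
  have hφb : ∀ z, |φ z (inner ℝ f (ξ z))| ≤ |a| + w := fun z => by
    have h := hφ z (inner ℝ f (ξ z))
    rw [abs_le]
    constructor <;> linarith [h.1, h.2, neg_abs_le a, le_abs_self a]
  have heval : ∀ k : Fin n, ∫ D' : Fin n → Z, φ (D' k) (inner ℝ f (ξ (D' k)))
      ∂(Measure.pi fun _ => P) = ∫ z, φ z (inner ℝ f (ξ z)) ∂P := fun k => by
    have h := measurePreserving_eval (fun _ : Fin n => P) k
    conv_rhs => rw [← h.map_eq]
    rw [integral_map h.measurable.aemeasurable hφf.aestronglyMeasurable]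
  have hinte : ∀ k : Fin n, Integrable (fun D' : Fin n → Z => φ (D' k) (inner ℝ f (ξ (D' k))))
      (Measure.pi fun _ => P) := fun k =>
    integrable_of_abs_le (hφf.comp (measurable_pi_apply k)) fun D' => hφb _
  have hdiff : ∀ k : Fin n, Integrable (fun D' : Fin n → Z =>
      φ (D' k) (inner ℝ f (ξ (D' k))) - φ (D k) (inner ℝ f (ξ (D k))))
      (Measure.pi fun _ => P) := fun k => (hinte k).sub (integrable_const _)
  have hgap : ∫ D', empGap ξ φ D D' f ∂(Measure.pi fun _ : Fin n => P)
      = ∫ z, φ z (inner ℝ f (ξ z)) ∂P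
        - (1 / (n : ℝ)) * ∑ k, φ (D k) (inner ℝ f (ξ (D k))) := by
    unfold empGap
    rw [integral_const_mul, integral_finsetSum _ fun k _ => hdiff k]
    simp_rw [integral_sub (hinte _) (integrable_const _), heval]
    simp only [integral_const, probReal_univ, one_smul, Finset.sum_sub_distrib, Finset.sum_const,
      Finset.card_univ, Fintype.card_fin, nsmul_eq_mul]
    field_simp
  have hle : ∫ D', empGap ξ φ D D' f ∂(Measure.pi fun _ : Fin n => P) ≤ Φ D := by
    have hint : Integrable (fun D' => empGap ξ φ D D' f) (Measure.pi fun _ : Fin n => P) :=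
      (integrable_finsetSum _ fun k _ => hdiff k).const_mul _
    have hsup : ∀ D', empGap ξ φ D D' f ≤ supGap ξ φ D D' := fun D' =>
      empGap_le_supGap hn hφ D D' hf
    exact integral_mono hint (hslice D) hsup
  have hD' : Φ D ≤ 2 * L * √(κ / n) + w * √(Real.log (1 / δ) / (2 * n)) := hD
  linarith

end UniformDeviation


/-! ### Euclidean norms and nearly orthonormal columns -/

section EuclideanNorm

variable {m k : Type*} [Fintype m] [Fintype k]

/-- The Euclidean norm of a plain vector. -/
noncomputable def euclNorm (v : m → ℝ) : ℝ := ‖WithLp.toLp 2 v‖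

theorem euclNorm_nonneg (v : m → ℝ) : 0 ≤ euclNorm v := norm_nonneg _

theorem euclNorm_sq (v : m → ℝ) : euclNorm v ^ 2 = ∑ i, v i ^ 2 := by
  simp [euclNorm, EuclideanSpace.norm_sq_eq]

theorem dotProduct_self_eq_euclNorm_sq (v : m → ℝ) : v ⬝ᵥ v = euclNorm v ^ 2 := by
  rw [euclNorm_sq, dotProduct]
  exact Finset.sum_congr rfl fun i _ => (sq _).symm

theorem abs_dotProduct_le (v w : m → ℝ) : |v ⬝ᵥ w| ≤ euclNorm v * euclNorm w := by
  have h := abs_real_inner_le_norm (WithLp.toLp 2 v) (WithLp.toLp 2 w)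
  rwa [EuclideanSpace.inner_toLp_toLp, star_trivial, dotProduct_comm] at h

theorem euclNorm_sub_le (v w : m → ℝ) : euclNorm (v - w) ≤ euclNorm v + euclNorm w :=
  norm_sub_le (WithLp.toLp 2 v) (WithLp.toLp 2 w)


theorem euclNorm_mulVec_le [DecidableEq k] (A : Matrix m k ℝ) (v : k → ℝ) :
    euclNorm (A *ᵥ v) ≤ ‖A‖ * euclNorm v :=
  Matrix.l2_opNorm_mulVec A (WithLp.toLp 2 v)

theorem euclNorm_transpose_mulVec_le [DecidableEq m] [DecidableEq k] (A : Matrix m k ℝ)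
    (v : m → ℝ) :
    euclNorm (Aᵀ *ᵥ v) ≤ ‖A‖ * euclNorm v := by
  rw [← Matrix.l2_opNorm_conjTranspose A, Matrix.conjTranspose_eq_transpose_of_trivial]
  exact euclNorm_mulVec_le _ _

/-- A matrix whose columns are nearly orthonormal solves `Bᵀ γ = w` with control of `γ`. -/
theorem exists_transpose_mulVec_eq [DecidableEq k] {B : Matrix m k ℝ} (hB : ‖Bᵀ * B - 1‖ ≤ 1 / 2)
    (w : k → ℝ) :
    ∃ γ : m → ℝ, Bᵀ *ᵥ γ = w ∧ euclNorm γ ≤ √2 * euclNorm w := by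
  -- In the quadratic form order `Bᵀ * B ≥ 1 / 2`; this yields both invertibility and the bound on
  -- `γ`.
  have hquad : ∀ x : k → ℝ, euclNorm x ^ 2 ≤ 2 * euclNorm (B *ᵥ x) ^ 2 := by
    intro x
    have h1 : x ⬝ᵥ ((Bᵀ * B - 1) *ᵥ x) = euclNorm (B *ᵥ x) ^ 2 - euclNorm x ^ 2 := by
      rw [Matrix.sub_mulVec, Matrix.one_mulVec, dotProduct_sub, dotProduct_self_eq_euclNorm_sq,
        ← Matrix.mulVec_mulVec, Matrix.dotProduct_mulVec, Matrix.vecMul_transpose,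
        dotProduct_self_eq_euclNorm_sq]
    have h2 := abs_dotProduct_le x ((Bᵀ * B - 1) *ᵥ x)
    have h3 := euclNorm_mulVec_le (Bᵀ * B - 1) x
    have h4 : euclNorm x * euclNorm ((Bᵀ * B - 1) *ᵥ x) ≤ euclNorm x * (1 / 2 * euclNorm x) :=
      mul_le_mul_of_nonneg_left
        (h3.trans (mul_le_mul_of_nonneg_right hB (euclNorm_nonneg x))) (euclNorm_nonneg x)
    rw [h1] at h2
    have h5 := (abs_le.1 h2).1
    nlinarith
  have hinj : Function.Injective (Bᵀ * B).mulVec := by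
    intro x y hxy
    have h0 : (Bᵀ * B) *ᵥ (x - y) = 0 := by rw [Matrix.mulVec_sub, hxy, sub_self]
    have h1 : euclNorm (B *ᵥ (x - y)) ^ 2 = 0 := by
      rw [← dotProduct_self_eq_euclNorm_sq, ← Matrix.vecMul_transpose, ← Matrix.dotProduct_mulVec,
        Matrix.vecMul_transpose, Matrix.mulVec_mulVec, h0, dotProduct_zero]
    have h2 := hquad (x - y)
    rw [h1, mul_zero, euclNorm_sq] at h2
    have h3 : ∑ i, (x - y) i ^ 2 = 0 := le_antisymm h2 (Finset.sum_nonneg fun i _ => sq_nonneg _)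
    rw [Finset.sum_eq_zero_iff_of_nonneg fun i _ => sq_nonneg _] at h3
    ext i
    have := pow_eq_zero_iff (two_ne_zero) |>.1 (h3 i (Finset.mem_univ i))
    simpa [sub_eq_zero] using this
  obtain ⟨x, hx⟩ := Matrix.mulVec_surjective_iff_isUnit.2
    (Matrix.mulVec_injective_iff_isUnit.1 hinj) w
  -- With `Bᵀ B x = w`, the vector `γ = B x` satisfies `‖γ‖² = ⟨x, w⟩ ≤ ‖x‖ ‖w‖ ≤ 2 ‖w‖²`.
  refine ⟨B *ᵥ x, by rw [Matrix.mulVec_mulVec]; exact hx, ?_⟩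
  have h1 : euclNorm (B *ᵥ x) ^ 2 ≤ euclNorm x * euclNorm w := by
    rw [← dotProduct_self_eq_euclNorm_sq, ← Matrix.vecMul_transpose, ← Matrix.dotProduct_mulVec,
        Matrix.vecMul_transpose, Matrix.mulVec_mulVec, hx]
    exact (le_abs_self _).trans (abs_dotProduct_le x w)
  have h2 := hquad x
  have hx0 := euclNorm_nonneg x
  have hw0 := euclNorm_nonneg w
  have h3 : euclNorm x ≤ 2 * euclNorm w := by
    by_contra! hlt
    nlinarith
  refine le_of_sq_le_sq ?_ (by positivity)
  rw [mul_pow, Real.sq_sqrt (by norm_num)]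
  nlinarith

end EuclideanNorm

/-! ### Sketching in the eigenbasis of the Gram matrix -/

section Spectrum

variable {n s : ℕ}

theorem criticalRadius_nonneg (μ : Fin n → ℝ) : 0 ≤ criticalRadius μ :=
  Real.sInf_nonneg fun _ hr => hr.1.le

/-- If the minimum is attained at `i + 1`, a zero-based index at least `i + 1` lies beyond `i` and
monotonicity applies. If it is the default `n`, no such index exists. -/
theorem eigenvalue_le_of_statDim_le {μ : Fin n → ℝ} (hμ : Antitone μ) {j : Fin n}
    (hj : statDim μ ≤ j) : μ j ≤ criticalRadius μ ^ 2 := by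
  have hne : ({j : ℕ | ∃ i : Fin n, j = (i : ℕ) + 1 ∧ μ i ≤ criticalRadius μ ^ 2} ∪ {n}).Nonempty :=
    ⟨n, Or.inr rfl⟩
  rcases Nat.sInf_mem hne with ⟨i, hi, hle⟩ | h
  · refine (hμ ?_).trans hle
    have : statDim μ = i + 1 := hi
    exact Fin.le_def.2 (by omega)
  · have : statDim μ = n := h
    have := j.2
    omega

theorem quadForm_eq_of_isEigendecomposition {A U : Matrix (Fin n) (Fin n) ℝ} {μ : Fin n → ℝ}
    (h : IsEigendecomposition A U μ) (u : Fin n → ℝ) :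
    u ⬝ᵥ A *ᵥ u = ∑ j, μ j * (Uᵀ *ᵥ u) j ^ 2 := by
  rw [h.eq_mul, ← Matrix.mulVec_mulVec, ← Matrix.mulVec_mulVec, Matrix.dotProduct_mulVec,
    ← Matrix.mulVec_transpose, dotProduct]
  refine Finset.sum_congr rfl fun j _ => ?_
  rw [Matrix.mulVec_diagonal]; ring

theorem eigenvalue_nonneg {A U : Matrix (Fin n) (Fin n) ℝ} {μ : Fin n → ℝ}
    (h : IsEigendecomposition A U μ) (hA : ∀ u : Fin n → ℝ, 0 ≤ u ⬝ᵥ A *ᵥ u) (j : Fin n) :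
    0 ≤ μ j := by
  have h1 := hA (U *ᵥ Pi.single j 1)
  rw [quadForm_eq_of_isEigendecomposition h, Matrix.mulVec_mulVec, h.orthogonal,
    Matrix.one_mulVec, Finset.sum_eq_single j] at h1
  · simpa using h1
  · intro k _ hk; simp [hk]
  · simp

theorem sum_sq_transpose_mulVec {U : Matrix (Fin n) (Fin n) ℝ} (hU : Uᵀ * U = 1)
    (v : Fin n → ℝ) : ∑ j, (Uᵀ *ᵥ v) j ^ 2 = euclNorm v ^ 2 := by
  have hU' : U * Uᵀ = 1 := mul_eq_one_comm.1 hU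
  rw [← euclNorm_sq, ← dotProduct_self_eq_euclNorm_sq, ← dotProduct_self_eq_euclNorm_sq]
  conv_lhs => rw [Matrix.mulVec_transpose, ← Matrix.dotProduct_mulVec, ← Matrix.mulVec_transpose,
    Matrix.mulVec_mulVec, hU', Matrix.one_mulVec]

/-- The range of the adjoint of a satisfiable sketch approximates every vector in the norm given
by the Gram matrix. -/
theorem exists_sketch_approx {A U : Matrix (Fin n) (Fin n) ℝ} {μ : Fin n → ℝ}
    (h : IsEigendecomposition A U μ) (hA : ∀ u : Fin n → ℝ, 0 ≤ u ⬝ᵥ A *ᵥ u) {c : ℝ} (hc : 0 < c)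
    {S : Matrix (Fin s) (Fin n) ℝ} (hS : IsSatisfiable U μ c S) (v : Fin n → ℝ) :
    ∃ γ : Fin s → ℝ, (v - Sᵀ *ᵥ γ) ⬝ᵥ A *ᵥ (v - Sᵀ *ᵥ γ)
      ≤ ((1 + √2 * c) * criticalRadius μ) ^ 2 * ∑ i, v i ^ 2 := by
  obtain ⟨hS1, hS2⟩ := hS
  set r := criticalRadius μ with hr
  have hr0 : 0 ≤ r := criticalRadius_nonneg μ
  -- This `γ` makes `v - Sᵀ γ` orthogonal to the leading eigenvectors, so only the tail enters the
  -- quadratic form.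
  obtain ⟨γ, hγ, hγn⟩ := exists_transpose_mulVec_eq hS1 ((leftBlock U (statDim μ))ᵀ *ᵥ v)
  refine ⟨γ, ?_⟩
  set d := statDim μ with hd
  have hv0 := euclNorm_nonneg v
  have hleft_apply : ∀ (u : Fin n → ℝ) (j : {j : Fin n // (j : ℕ) < d}),
      ((leftBlock U d)ᵀ *ᵥ u) j = (Uᵀ *ᵥ u) j := fun u j => rfl
  have hright_apply : ∀ (u : Fin n → ℝ) (j : {j : Fin n // d ≤ (j : ℕ)}),
      ((rightBlock U d)ᵀ *ᵥ u) j = (Uᵀ *ᵥ u) j := fun u j => rfl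
  have hsub : ∀ (p : Fin n → Prop) [DecidablePred p] (g : Fin n → ℝ),
      ∑ j : {j : Fin n // p j}, g j = ∑ j ∈ Finset.univ.filter p, g j := fun p _ g =>
    (Finset.sum_subtype _ (by simp) g).symm
  have hleft_norm : euclNorm ((leftBlock U d)ᵀ *ᵥ v) ≤ euclNorm v := by
    refine le_of_sq_le_sq ?_ hv0
    rw [euclNorm_sq, ← sum_sq_transpose_mulVec h.orthogonal v]
    simp_rw [hleft_apply]
    rw [hsub (fun j => (j : ℕ) < d) fun j => (Uᵀ *ᵥ v) j ^ 2]
    exact Finset.sum_le_sum_of_subset_of_nonneg (Finset.subset_univ _) fun _ _ _ => sq_nonneg _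
  have hright_norm : euclNorm ((rightBlock U d)ᵀ *ᵥ v) ≤ euclNorm v := by
    refine le_of_sq_le_sq ?_ hv0
    rw [euclNorm_sq, ← sum_sq_transpose_mulVec h.orthogonal v]
    simp_rw [hright_apply]
    rw [hsub (fun j => d ≤ (j : ℕ)) fun j => (Uᵀ *ᵥ v) j ^ 2]
    exact Finset.sum_le_sum_of_subset_of_nonneg (Finset.subset_univ _) fun _ _ _ => sq_nonneg _
  have hleft_zero : ∀ j : Fin n, (j : ℕ) < d → (Uᵀ *ᵥ (v - Sᵀ *ᵥ γ)) j = 0 := by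
    intro j hj
    rw [← hleft_apply _ ⟨j, hj⟩, Matrix.mulVec_sub, Matrix.mulVec_mulVec, ← Matrix.transpose_mul,
      hγ, sub_self, Pi.zero_apply]
  set Λ : Matrix {j : Fin n // d ≤ (j : ℕ)} {j : Fin n // d ≤ (j : ℕ)} ℝ :=
    Matrix.diagonal fun j => √(μ j) with hΛ
  have hμ0 := eigenvalue_nonneg h hA
  have hquad : (v - Sᵀ *ᵥ γ) ⬝ᵥ A *ᵥ (v - Sᵀ *ᵥ γ)
      = euclNorm (Λ *ᵥ ((rightBlock U d)ᵀ *ᵥ (v - Sᵀ *ᵥ γ))) ^ 2 := by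
    rw [quadForm_eq_of_isEigendecomposition h, euclNorm_sq]
    simp_rw [hΛ, Matrix.mulVec_diagonal, mul_pow, Real.sq_sqrt (hμ0 _), hright_apply]
    rw [hsub (fun j => d ≤ (j : ℕ)) fun j => μ j * (Uᵀ *ᵥ (v - Sᵀ *ᵥ γ)) j ^ 2]
    refine (Finset.sum_subset (Finset.subset_univ _) fun j _ hj => ?_).symm
    rw [hleft_zero j (by simpa using hj)]; ring
  -- The tail of `v` is damped by eigenvalues at most `r²`; the spill of `Sᵀ γ` into the tail is
  -- controlled by the second satisfiability condition.
  have hsplit : Λ *ᵥ ((rightBlock U d)ᵀ *ᵥ (v - Sᵀ *ᵥ γ))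
      = Λ *ᵥ ((rightBlock U d)ᵀ *ᵥ v) - (S * rightBlock U d * Λ)ᵀ *ᵥ γ := by
    rw [Matrix.transpose_mul, Matrix.transpose_mul, hΛ, Matrix.diagonal_transpose,
      Matrix.mulVec_sub, Matrix.mulVec_sub, Matrix.mulVec_mulVec, Matrix.mulVec_mulVec,
      Matrix.mulVec_mulVec, ← Matrix.mulVec_mulVec, ← Matrix.mulVec_mulVec]
    simp only [Matrix.mulVec_mulVec, Matrix.mul_assoc]
  have h1 : euclNorm (Λ *ᵥ ((rightBlock U d)ᵀ *ᵥ v)) ≤ r * euclNorm v := by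
    refine le_trans ?_ (mul_le_mul_of_nonneg_left hright_norm hr0)
    refine le_of_sq_le_sq ?_ (mul_nonneg hr0 (euclNorm_nonneg _))
    rw [mul_pow, euclNorm_sq, euclNorm_sq, Finset.mul_sum]
    refine Finset.sum_le_sum fun j _ => ?_
    rw [hΛ, Matrix.mulVec_diagonal, mul_pow, Real.sq_sqrt (hμ0 _)]
    exact mul_le_mul_of_nonneg_right (eigenvalue_le_of_statDim_le h.antitone j.2) (sq_nonneg _)
  have h2 : euclNorm ((S * rightBlock U d * Λ)ᵀ *ᵥ γ) ≤ c * r * (√2 * euclNorm v) := by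
    refine (euclNorm_transpose_mulVec_le _ _).trans ?_
    refine mul_le_mul hS2 (hγn.trans (mul_le_mul_of_nonneg_left hleft_norm (by positivity)))
      (euclNorm_nonneg _) (by positivity)
  rw [hquad, hsplit, ← euclNorm_sq, ← mul_pow]
  refine pow_le_pow_left₀ (euclNorm_nonneg _) ((euclNorm_sub_le _ _).trans ?_) 2
  calc _ ≤ r * euclNorm v + c * r * (√2 * euclNorm v) := add_le_add h1 h2
    _ = _ := by ring

end Spectrum

/-! ### Approximation of the unit ball by sketched functions -/

section Approximation

variable {X : Type*} {H : Type*} [NormedAddCommGroup H] [InnerProductSpace ℝ H] [CompleteSpace H]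
  [RKHS ℝ H X ℝ] {n s : ℕ}

theorem inner_kerSection (f : H) (x : X) : inner ℝ f (kerSection H x) = f x := by
  rw [kerSection, RKHS.inner_kerFun]; simp

theorem inner_kerSection_kerSection (x x' : X) :
    inner ℝ (kerSection H x) (kerSection H x') = ker H x x' := by
  rw [real_inner_comm, inner_kerSection, kerSection_apply]

theorem norm_kerSection_sq (x : X) : ‖kerSection H x‖ ^ 2 = ker H x x := by
  rw [← real_inner_self_eq_norm_sq, inner_kerSection_kerSection]

theorem abs_apply_le {κ : ℝ} (hκ : ∀ x x' : X, ker H x x' ≤ κ) {f : H} (hf : ‖f‖ ≤ 1) (x : X) :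
    |f x| ≤ √κ := by
  rw [← inner_kerSection]
  refine (abs_real_inner_le_norm _ _).trans ?_
  refine (mul_le_of_le_one_left (norm_nonneg _) hf).trans (Real.le_sqrt_of_sq_le ?_)
  rw [norm_kerSection_sq]
  exact hκ x x

theorem inner_sum_kerSection (f : H) (x : Fin n → X) (α : Fin n → ℝ) :
    inner ℝ f (∑ i, α i • kerSection H (x i)) = ∑ i, α i * f (x i) := by
  simp_rw [inner_sum, real_inner_smul_right, inner_kerSection]

theorem sum_kerSection_apply (x : Fin n → X) (α : Fin n → ℝ) (j : Fin n) :
    (∑ i, α i • kerSection H (x i)) (x j) = (gram H x *ᵥ α) j := by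
  rw [← inner_kerSection, sum_inner, Matrix.mulVec, dotProduct]
  refine Finset.sum_congr rfl fun i _ => ?_
  rw [real_inner_smul_left, real_inner_comm, inner_kerSection_kerSection, mul_comm]
  rfl

theorem norm_sum_kerSection_sq (x : Fin n → X) (α : Fin n → ℝ) :
    ‖∑ i, α i • kerSection H (x i)‖ ^ 2 = α ⬝ᵥ gram H x *ᵥ α := by
  rw [← real_inner_self_eq_norm_sq, inner_sum_kerSection, dotProduct]
  simp_rw [sum_kerSection_apply]

theorem sketchedObjective_eq (ℓ : ℝ → ℝ → ℝ) (lam : ℝ) (x : Fin n → X) (y : Fin n → ℝ)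
    (S : Matrix (Fin s) (Fin n) ℝ) (γ : Fin s → ℝ) :
    sketchedObjective H ℓ lam x y S γ
      = (1 / (n : ℝ)) * ∑ i, ℓ (sketchedFun H x S γ (x i)) (y i)
        + lam / 2 * ‖sketchedFun H x S γ‖ ^ 2 := by
  unfold sketchedObjective sketchedFun
  rw [norm_sum_kerSection_sq]
  simp_rw [sum_kerSection_apply, Matrix.mulVec_mulVec]
  congr 2
  rw [← Matrix.mulVec_mulVec, ← Matrix.mulVec_mulVec, Matrix.dotProduct_mulVec,
    ← Matrix.mulVec_transpose, Matrix.mulVec_mulVec]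

/-- The functions spanned by a satisfiable sketch approximate every function of the unit ball on
the sample, without increasing the norm. -/
theorem exists_sketchedFun_approx (hn : 0 < n) {x : Fin n → X} {U : Matrix (Fin n) (Fin n) ℝ}
    {μ : Fin n → ℝ} (h : IsEigendecomposition ((1 / (n : ℝ)) • gram H x) U μ) {c : ℝ} (hc : 0 < c)
    {S : Matrix (Fin s) (Fin n) ℝ} (hS : IsSatisfiable U μ c S) {f : H} (hf : ‖f‖ ≤ 1) :
    ∃ γ : Fin s → ℝ, ‖sketchedFun H x S γ‖ ≤ 1 ∧ ‖sketchedFun H x S γ - f‖ ≤ 1 ∧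
      (1 / (n : ℝ)) * ∑ i, (sketchedFun H x S γ - f) (x i) ^ 2
        ≤ ((1 + √2 * c) * criticalRadius μ) ^ 2 := by
  have hn' : (0 : ℝ) < n := by exact_mod_cast hn
  let T : (Fin s → ℝ) →ₗ[ℝ] H :=
    { toFun := sketchedFun H x S
      map_add' := fun γ γ' => by
        simp only [sketchedFun, Matrix.mulVec_add, Pi.add_apply, add_smul, Finset.sum_add_distrib]
      map_smul' := fun a γ => by
        simp only [sketchedFun, Matrix.mulVec_smul, Pi.smul_apply, smul_eq_mul, mul_smul,
          ← Finset.smul_sum, RingHom.id_apply] }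
  have hT : ∀ γ, T γ = sketchedFun H x S γ := fun γ => rfl
  let V : Submodule ℝ H := T.range
  obtain ⟨γ₀, hγ₀⟩ : ∃ γ, T γ = V.starProjection f := V.starProjection_apply_mem f
  have hperp : V.starProjection f - f ∈ Vᗮ := by
    rw [← neg_sub]
    exact Vᗮ.neg_mem (V.sub_starProjection_mem_orthogonal f)
  refine ⟨γ₀, ?_, ?_, ?_⟩
  · rw [← hT, hγ₀]
    exact (V.norm_starProjection_apply_le f).trans hf
  · rw [← hT, hγ₀, norm_sub_rev, ← Submodule.starProjection_orthogonal_val]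
    exact (Vᗮ.norm_starProjection_apply_le f).trans hf
  · rw [← hT, hγ₀]
    set g := V.starProjection f - f with hg
    have hgn : ‖g‖ ≤ 1 := by
      rw [hg, norm_sub_rev, ← Submodule.starProjection_orthogonal_val]
      exact (Vᗮ.norm_starProjection_apply_le f).trans hf
    set v : Fin n → ℝ := fun i => g (x i) with hv
    have hquad : ∀ u : Fin n → ℝ, u ⬝ᵥ ((1 / (n : ℝ)) • gram H x) *ᵥ u
        = (1 / (n : ℝ)) * ‖∑ i, u i • kerSection H (x i)‖ ^ 2 := fun u => by
      rw [norm_sum_kerSection_sq, Matrix.smul_mulVec, dotProduct_smul, smul_eq_mul]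
    obtain ⟨γ, hγ⟩ := exists_sketch_approx h (fun u => by rw [hquad]; positivity) hc hS v
    rw [hquad] at hγ
    -- Orthogonality of `g` to every sketched function allows `Sᵀ γ` to be subtracted from `v` for
    -- free.
    have hsum : ∑ i, v i ^ 2 = inner ℝ g (∑ i, (v - Sᵀ *ᵥ γ) i • kerSection H (x i)) := by
      have h1 : ∑ i, (v - Sᵀ *ᵥ γ) i • kerSection H (x i)
          = ∑ i, v i • kerSection H (x i) - T γ := by
        rw [hT, sketchedFun, ← Finset.sum_sub_distrib]
        simp only [Pi.sub_apply, sub_smul]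
      rw [h1, inner_sub_right, Submodule.inner_left_of_mem_orthogonal (LinearMap.mem_range_self T γ)
        hperp, sub_zero, inner_sum_kerSection]
      exact Finset.sum_congr rfl fun i _ => sq _
    have hle : (∑ i, v i ^ 2) ^ 2 ≤ ‖∑ i, (v - Sᵀ *ᵥ γ) i • kerSection H (x i)‖ ^ 2 := by
      refine pow_le_pow_left₀ (Finset.sum_nonneg fun i _ => sq_nonneg _) ?_ 2
      rw [hsum]
      exact (real_inner_le_norm _ _).trans (mul_le_of_le_one_left (norm_nonneg _) hgn)
    have hfin : (1 / (n : ℝ)) * (∑ i, v i ^ 2) ^ 2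
        ≤ ((1 + √2 * c) * criticalRadius μ) ^ 2 * ∑ i, v i ^ 2 :=
      (mul_le_mul_of_nonneg_left hle (by positivity)).trans hγ
    rcases (Finset.sum_nonneg fun i _ => sq_nonneg (v i) : 0 ≤ ∑ i, v i ^ 2).eq_or_lt with h0 | h0
    · change (1 / (n : ℝ)) * ∑ i, v i ^ 2 ≤ _
      rw [← h0, mul_zero]
      positivity
    · refine le_of_mul_le_mul_right ?_ h0
      calc _ = (1 / (n : ℝ)) * (∑ i, v i ^ 2) ^ 2 := by rw [sq (∑ i, v i ^ 2), ← mul_assoc]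
        _ ≤ _ := hfin

/-- The competitor has norm at most 1, so its penalty is at most `lam / 2`; the penalty of the
solution is dropped. -/
theorem empirical_le_of_isSketchedSolution {ℓ : ℝ → ℝ → ℝ} {lam : ℝ} (hlam : 0 < lam)
    {x : Fin n → X}
    {y : Fin n → ℝ} {S : Matrix (Fin s) (Fin n) ℝ} {γ γ' : Fin s → ℝ}
    (h : IsSketchedSolution H ℓ lam x y S γ) (hγ' : ‖sketchedFun H x S γ'‖ ≤ 1) :
    (1 / (n : ℝ)) * ∑ i, ℓ (sketchedFun H x S γ (x i)) (y i)
      ≤ (1 / (n : ℝ)) * ∑ i, ℓ (sketchedFun H x S γ' (x i)) (y i) + lam / 2 := by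
  have h1 := h.2 γ' hγ'
  rw [sketchedObjective_eq, sketchedObjective_eq] at h1
  have h2 : lam / 2 * ‖sketchedFun H x S γ'‖ ^ 2 ≤ lam / 2 * 1 :=
    mul_le_mul_of_nonneg_left (pow_le_one₀ (norm_nonneg _) hγ') (by linarith)
  have h3 : 0 ≤ lam / 2 * ‖sketchedFun H x S γ‖ ^ 2 := by positivity
  linarith

end Approximation


/-! ### Losses controlled only almost surely and on a range -/

section TruncatedDeviation

theorem one_sub_ofReal_add_le_measure_inter {Ω : Type*} [MeasurableSpace Ω] {ν : Measure Ω}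
    [IsProbabilityMeasure ν] {A B : Set Ω} (hA : MeasurableSet A) (hB : MeasurableSet B) {a b : ℝ}
    (ha : 0 ≤ a) (hb : 0 ≤ b) (hνA : 1 - ENNReal.ofReal a ≤ ν A)
    (hνB : 1 - ENNReal.ofReal b ≤ ν B) : 1 - ENNReal.ofReal (a + b) ≤ ν (A ∩ B) := by
  have hcompl : ∀ {C : Set Ω} {c : ℝ}, MeasurableSet C → 1 - ENNReal.ofReal c ≤ ν C →
      ν Cᶜ ≤ ENNReal.ofReal c := fun {C c} hC h => by
    rw [prob_compl_eq_one_sub hC, tsub_le_iff_left]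
    exact tsub_le_iff_right.1 h
  have h : ν (A ∩ B)ᶜ ≤ ENNReal.ofReal (a + b) := by
    rw [compl_inter, ENNReal.ofReal_add ha hb]
    exact (measure_union_le _ _).trans (add_le_add (hcompl hA hνA) (hcompl hB hνB))
  rw [prob_compl_eq_one_sub (hA.inter hB)] at h
  rw [tsub_le_iff_right] at h ⊢
  rwa [add_comm]

variable {Z : Type*} [MeasurableSpace Z] {H : Type*} [NormedAddCommGroup H]
  [InnerProductSpace ℝ H] {P : Measure Z} [IsProbabilityMeasure P]

/-- `uniform_deviation` for a loss which is well behaved only on an almost sure event and on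
the range of the functions considered. -/
theorem uniform_deviation_of_mem_Icc {ξ : Z → H} {φ : Z → ℝ → ℝ} {a w : ℝ} {n : ℕ} {L : ℝ≥0}
    {κ : ℝ} (hn : 0 < n) (hξ : Measurable fun p : Z × Z => inner ℝ (ξ p.1) (ξ p.2))
    (hκ : ∀ z, ‖ξ z‖ ^ 2 ≤ κ) (hξf : ∀ f : H, Measurable fun z => inner ℝ f (ξ z))
    (hφm : Measurable (Function.uncurry φ)) (hw : 0 < w)
    {E : Set Z} (hE : MeasurableSet E) (hPE : ∀ᵐ z ∂P, z ∈ E) {lo hi : Z → ℝ}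
    (hlo : Measurable lo) (hhi : Measurable hi) (hle : ∀ z ∈ E, lo z ≤ hi z)
    (hφ : ∀ z ∈ E, ∀ t ∈ Icc (lo z) (hi z), φ z t ∈ Icc a (a + w))
    (hL : ∀ z ∈ E, ∀ t ∈ Icc (lo z) (hi z), ∀ t' ∈ Icc (lo z) (hi z),
      |φ z t - φ z t'| ≤ L * |t - t'|)
    {δ : ℝ} (hδ : δ ∈ Ioo (0 : ℝ) 1) :
    ∃ A : Set (Fin n → Z), MeasurableSet A ∧
      1 - ENNReal.ofReal δ ≤ Measure.pi (fun _ : Fin n => P) A ∧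
      ∀ D ∈ A, (∀ k, D k ∈ E) ∧ ∀ f : H, ‖f‖ ≤ 1 →
        (∀ z ∈ E, inner ℝ f (ξ z) ∈ Icc (lo z) (hi z)) →
        ∫ z, φ z (inner ℝ f (ξ z)) ∂P ≤ (1 / (n : ℝ)) * ∑ k, φ (D k) (inner ℝ f (ξ (D k)))
          + 2 * L * √(κ / n) + w * √(Real.log (1 / δ) / (2 * n)) := by
  classical
  -- Clamping the prediction to `[lo z, hi z]`, and using the constant `a` off `E`, gives a globally
  -- bounded Lipschitz loss that agrees with `φ` wherever it is evaluated.
  set cl : Z → ℝ → ℝ := fun z t => max (lo z) (min (hi z) t) with hcl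
  have hclmem : ∀ z ∈ E, ∀ t, cl z t ∈ Icc (lo z) (hi z) := fun z hz t =>
    ⟨le_max_left _ _, max_le (hle z hz) (min_le_left _ _)⟩
  have hclid : ∀ z t, t ∈ Icc (lo z) (hi z) → cl z t = t := fun z t ht => by
    rw [hcl]; dsimp only; rw [min_eq_right ht.2, max_eq_right ht.1]
  have hcllip : ∀ z, LipschitzWith 1 (cl z) := fun z =>
    (LipschitzWith.id.const_min _).const_max _
  set ψ : Z → ℝ → ℝ := fun z t => if z ∈ E then φ z (cl z t) else a with hψ
  have hψE : ∀ z ∈ E, ∀ t ∈ Icc (lo z) (hi z), ψ z t = φ z t := fun z hz t ht => by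
    rw [hψ]; dsimp only; rw [if_pos hz, hclid z t ht]
  have hψm : Measurable (Function.uncurry ψ) := by
    have h : Measurable fun p : Z × ℝ => φ p.1 (cl p.1 p.2) :=
      hφm.comp (measurable_fst.prodMk
        ((hlo.comp measurable_fst).max ((hhi.comp measurable_fst).min measurable_snd)))
    exact Measurable.ite (measurable_fst hE) h measurable_const
  have hψb : ∀ z t, ψ z t ∈ Icc a (a + w) := fun z t => by
    rw [hψ]; dsimp only
    split_ifs with hz
    · exact hφ z hz _ (hclmem z hz t)
    · exact ⟨le_rfl, by linarith⟩
  have hψL : ∀ z, LipschitzWith L (ψ z) := fun z => by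
    by_cases hz : z ∈ E
    · refine LipschitzWith.of_dist_le_mul fun t t' => ?_
      rw [Real.dist_eq, hψ]; dsimp only
      rw [if_pos hz, if_pos hz]
      refine (hL z hz _ (hclmem z hz t) _ (hclmem z hz t')).trans ?_
      have := (hcllip z).dist_le_mul t t'
      rw [NNReal.coe_one, one_mul, Real.dist_eq (cl z t)] at this
      exact mul_le_mul_of_nonneg_left this L.coe_nonneg
    · have : ψ z = fun _ => a := by ext t; rw [hψ]; dsimp only; rw [if_neg hz]
      rw [this]
      exact LipschitzWith.const' a
  obtain ⟨A, hA, hPA, hAD⟩ := uniform_deviation (P := P) hn hξ hκ hξf hψm hw hψb hψL hδ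
  have hFm : MeasurableSet (univ.pi fun _ : Fin n => E) :=
    MeasurableSet.univ_pi fun _ => hE
  have hF : (Measure.pi fun _ : Fin n => P) (univ.pi fun _ => E) = 1 := by
    have : P E = 1 := (mem_ae_iff_prob_eq_one hE).1 hPE
    rw [Measure.pi_pi]
    simp [this]
  refine ⟨A ∩ univ.pi fun _ => E, hA.inter hFm, ?_, fun D hD => ?_⟩
  · have := one_sub_ofReal_add_le_measure_inter hA hFm hδ.1.le le_rfl hPA (b := 0)
      (by rw [hF]; simp)
    rwa [add_zero] at this
  · have hDE : ∀ k, D k ∈ E := fun k => hD.2 k (mem_univ k)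
    refine ⟨hDE, fun f hf hfE => ?_⟩
    have h := hAD D hD.1 f hf
    have e1 : ∫ z, ψ z (inner ℝ f (ξ z)) ∂P = ∫ z, φ z (inner ℝ f (ξ z)) ∂P := by
      refine integral_congr_ae ?_
      filter_upwards [hPE] with z hz
      exact hψE z hz _ (hfE z hz)
    have e2 : ∑ k, ψ (D k) (inner ℝ f (ξ (D k))) = ∑ k, φ (D k) (inner ℝ f (ξ (D k))) :=
      Finset.sum_congr rfl fun k _ => hψE _ (hDE k) _ (hfE _ (hDE k))
    rwa [e1, e2] at h

end TruncatedDeviation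

/-! ### Measurability in the RKHS, and true against empirical risk -/

section Risk

variable {X : Type*} [MeasurableSpace X] {H : Type*} [NormedAddCommGroup H]
  [InnerProductSpace ℝ H] [CompleteSpace H] [RKHS ℝ H X ℝ]

/-- Kernel sections span a dense subspace, and norm convergence implies pointwise convergence, so
every `f` is a pointwise limit of measurable functions. -/
theorem measurable_coe_of_measurable_ker
    (hker : Measurable fun p : X × X => ker H p.1 p.2) (f : H) : Measurable f := by
  have hsec : ∀ x' : X, Measurable (kerSection H x' : X → ℝ) := fun x' => by
    have : (kerSection H x' : X → ℝ) = fun x => ker H x x' := by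
      ext x; exact kerSection_apply H x x'
    rw [this]
    have h : Measurable fun x : X => (x, x') := measurable_prodMk_right
    have h' := Measurable.comp hker h
    exact h'
  have hspan : ∀ g ∈ Submodule.span ℝ {g : H | ∃ (x : X) (v : ℝ), RKHS.kerFun H x v = g},
      Measurable (g : X → ℝ) := by
    intro g hg
    induction hg using Submodule.span_induction with
    | mem g hg =>
      obtain ⟨x, v, rfl⟩ := hg
      have : RKHS.kerFun H x v = v • kerSection H x := by
        rw [kerSection, ← map_smul, smul_eq_mul, mul_one]
      rw [this, RKHS.coe_smul]
      exact (hsec x).const_smul v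
    | zero => rw [RKHS.coe_zero]; exact measurable_const
    | add g g' _ _ h h' => rw [RKHS.coe_add]; exact h.add h'
    | smul c g _ h => rw [RKHS.coe_smul]; exact h.const_smul c
  have hf : f ∈ (Submodule.span ℝ
      {g : H | ∃ (x : X) (v : ℝ), RKHS.kerFun H x v = g}).topologicalClosure := by
    rw [RKHS.kerFun_dense]; trivial
  obtain ⟨u, hu, hlim⟩ := mem_closure_iff_seq_limit.1 hf
  refine measurable_of_tendsto_metrizable (fun k => hspan (u k) (hu k)) ?_
  rw [tendsto_pi_nhds]
  exact fun x => ((RKHS.continuous_eval x).tendsto f).comp hlim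

theorem measurable_inner_kerSection (hker : Measurable fun p : X × X => ker H p.1 p.2) :
    Measurable fun p : (X × ℝ) × (X × ℝ) =>
      inner ℝ (kerSection H p.1.1) (kerSection H p.2.1) := by
  simp_rw [inner_kerSection_kerSection]
  have h : Measurable fun p : (X × ℝ) × (X × ℝ) => (p.1.1, p.2.1) :=
    (measurable_fst.comp measurable_fst).prodMk (measurable_fst.comp measurable_snd)
  have h' := Measurable.comp hker h
  exact h'

/-- Needed because the label set `𝒴` is not assumed measurable. -/
theorem exists_measurableSet_ae_subset {Z : Type*} [MeasurableSpace Z] {P : Measure Z}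
    {p : Z → Prop} (h : ∀ᵐ z ∂P, p z) :
    ∃ E : Set Z, MeasurableSet E ∧ (∀ᵐ z ∂P, z ∈ E) ∧ ∀ z ∈ E, p z := by
  obtain ⟨t, ht, htm, ht0⟩ := exists_measurable_superset_of_null (ae_iff.1 h)
  refine ⟨tᶜ, htm.compl, ?_, fun z hz => ?_⟩
  · rw [ae_iff]; simpa using ht0
  · by_contra hp
    exact hz (ht hp)

variable {κ : ℝ} {𝒴 : Set ℝ} {P : Measure (X × ℝ)} [IsProbabilityMeasure P] {ℓ : ℝ → ℝ → ℝ}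
  {n : ℕ}

/-- With high probability, the risk is controlled by the empirical risk uniformly over the unit
ball. -/
theorem risk_le_empirical (hker : Measurable fun p : X × X => ker H p.1 p.2)
    (hκ : ∀ x x' : X, ker H x x' ≤ κ) (hP : ∀ᵐ p ∂P, p.2 ∈ 𝒴)
    (hℓ : Measurable (Function.uncurry ℓ))
    (hbdd : ∀ y ∈ 𝒴, ∀ z : ℝ, |z| ≤ √κ → 0 ≤ ℓ z y ∧ ℓ z y ≤ 2) {L : ℝ≥0}
    (hL : ∀ y ∈ 𝒴, ∀ z z' : ℝ, |z| ≤ √κ → |z'| ≤ √κ → |ℓ z y - ℓ z' y| ≤ L * |z - z'|)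
    (hn : 0 < n) {δ : ℝ} (hδ : δ ∈ Ioo (0 : ℝ) 1) :
    ∃ A : Set (Fin n → X × ℝ), MeasurableSet A ∧
      1 - ENNReal.ofReal δ ≤ Measure.pi (fun _ : Fin n => P) A ∧
      ∀ D ∈ A, (∀ k, (D k).2 ∈ 𝒴) ∧ ∀ f : H, ‖f‖ ≤ 1 →
        risk P ℓ f ≤ (1 / (n : ℝ)) * ∑ k, ℓ (f (D k).1) (D k).2
          + 2 * L * √(κ / n) + 2 * √(Real.log (1 / δ) / (2 * n)) := by
  obtain ⟨E, hE, hPE, hE𝒴⟩ := exists_measurableSet_ae_subset hP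
  obtain ⟨A, hA, hPA, hAD⟩ := uniform_deviation_of_mem_Icc (P := P) (n := n)
    (ξ := fun p : X × ℝ => kerSection H p.1) (φ := fun p t => ℓ t p.2) (a := 0) (w := 2) (L := L)
    (κ := κ) hn (measurable_inner_kerSection hker)
    (fun p => by rw [norm_kerSection_sq]; exact hκ _ _)
    (fun f => by
      simp_rw [inner_kerSection]
      exact (measurable_coe_of_measurable_ker hker f).comp measurable_fst)
    (hℓ.comp (measurable_snd.prodMk (measurable_snd.comp measurable_fst)))
    two_pos hE hPE (lo := fun _ => -√κ) (hi := fun _ => √κ) measurable_const measurable_const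
    (fun _ _ => by linarith [Real.sqrt_nonneg κ])
    (fun p hp t ht => by
      have := hbdd p.2 (hE𝒴 p hp) t (abs_le.2 ht)
      exact ⟨this.1, by linarith [this.2]⟩)
    (fun p hp t ht t' ht' => hL p.2 (hE𝒴 p hp) t t' (abs_le.2 ht) (abs_le.2 ht'))
    hδ
  refine ⟨A, hA, hPA, fun D hD => ⟨fun k => hE𝒴 _ ((hAD D hD).1 k), fun f hf => ?_⟩⟩
  have h := (hAD D hD).2 f hf fun p _ => by
    rw [inner_kerSection]; exact abs_le.1 (abs_apply_le hκ hf p.1)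
  simp only [inner_kerSection] at h
  exact h

/-- With high probability, the empirical risk of a fixed function of the unit ball is controlled
by its risk. -/
theorem empirical_le_risk (hker : Measurable fun p : X × X => ker H p.1 p.2)
    (hκ : ∀ x x' : X, ker H x x' ≤ κ) (hP : ∀ᵐ p ∂P, p.2 ∈ 𝒴)
    (hℓ : Measurable (Function.uncurry ℓ))
    (hbdd : ∀ y ∈ 𝒴, ∀ z : ℝ, |z| ≤ √κ → 0 ≤ ℓ z y ∧ ℓ z y ≤ 2)
    (hn : 0 < n) {δ : ℝ} (hδ : δ ∈ Ioo (0 : ℝ) 1) {f : H} (hf : ‖f‖ ≤ 1) :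
    ∃ A : Set (Fin n → X × ℝ), MeasurableSet A ∧
      1 - ENNReal.ofReal δ ≤ Measure.pi (fun _ : Fin n => P) A ∧
      ∀ D ∈ A, (1 / (n : ℝ)) * ∑ k, ℓ (f (D k).1) (D k).2
          ≤ risk P ℓ f + 2 * √(Real.log (1 / δ) / (2 * n)) := by
  obtain ⟨E, hE, hPE, hE𝒴⟩ := exists_measurableSet_ae_subset hP
  have hfm := measurable_coe_of_measurable_ker hker f
  -- The negated loss of the fixed `f`, regarded as independent of the prediction, is Lipschitz with
  -- `L = 0`. The complexity term vanishes, and the bound at the function `0` is a one-sided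
  -- Hoeffding inequality.
  obtain ⟨A, hA, hPA, hAD⟩ := uniform_deviation_of_mem_Icc (P := P) (n := n)
    (ξ := fun p : X × ℝ => kerSection H p.1) (φ := fun p _ => -ℓ (f p.1) p.2) (a := -2) (w := 2)
    (L := 0) (κ := κ) hn (measurable_inner_kerSection hker)
    (fun p => by rw [norm_kerSection_sq]; exact hκ _ _)
    (fun g => by
      simp_rw [inner_kerSection]
      exact (measurable_coe_of_measurable_ker hker g).comp measurable_fst)
    ((hℓ.comp ((hfm.comp (measurable_fst.comp measurable_fst)).prodMk
      (measurable_snd.comp measurable_fst))).neg)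
    two_pos hE hPE (lo := fun _ => -√κ) (hi := fun _ => √κ) measurable_const measurable_const
    (fun _ _ => by linarith [Real.sqrt_nonneg κ])
    (fun p hp t ht => by
      have := hbdd p.2 (hE𝒴 p hp) (f p.1) (abs_apply_le hκ hf _)
      constructor <;> linarith [this.1, this.2])
    (fun p hp t ht t' ht' => by simp)
    hδ
  refine ⟨A, hA, hPA, fun D hD => ?_⟩
  have h := (hAD D hD).2 0 (by simp) fun p _ => by simp
  rw [integral_neg, Finset.sum_neg_distrib, mul_neg] at h
  simp only [NNReal.coe_zero, mul_zero, zero_mul, add_zero] at h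
  unfold risk
  linarith

theorem nonneg_of_ker_le (P : Measure (X × ℝ)) [IsProbabilityMeasure P]
    (hκ : ∀ x x' : X, ker H x x' ≤ κ) : 0 ≤ κ := by
  obtain ⟨p⟩ := P.nonempty_of_neZero
  have h := hκ p.1 p.1
  rw [← norm_kerSection_sq] at h
  exact (sq_nonneg _).trans h

/-- Converts the deviation at level `δ / 2`, used for each of two events, into the form of the final
bound. -/
theorem sqrt_log_half_le (hn : 0 < n) {δ : ℝ} (hδ : δ ∈ Ioo (0 : ℝ) 1) :
    √(Real.log (1 / (δ / 2)) / (2 * n)) ≤ √(8 * Real.log (4 / δ) / n) / 4 := by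
  have hn' : (0 : ℝ) < n := by exact_mod_cast hn
  have hδ0 := hδ.1
  have hlog : Real.log (1 / (δ / 2)) ≤ Real.log (4 / δ) := by
    refine Real.log_le_log (by positivity) ?_
    rw [one_div_div]
    gcongr
    norm_num
  have h4 : √(8 * Real.log (4 / δ) / n) / 4 = √(Real.log (4 / δ) / (2 * n)) := by
    rw [div_eq_iff (by norm_num), show (4 : ℝ) = √16 by
      rw [show (16 : ℝ) = 4 ^ 2 by norm_num, Real.sqrt_sq (by norm_num)],
      ← Real.sqrt_mul' _ (by norm_num)]
    congr 1
    rw [show √16 = (4 : ℝ) by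
      rw [show (16 : ℝ) = 4 ^ 2 by norm_num, Real.sqrt_sq (by norm_num)]]
    field_simp; ring
  rw [h4]
  gcongr

end Risk


/-! ### Effect of the residual on the empirical risk -/

section Sampling

variable {X : Type*} {H : Type*} [NormedAddCommGroup H]
  [InnerProductSpace ℝ H] [RKHS ℝ H X ℝ] {n : ℕ}

theorem empirical_lipschitz_le (hn : 0 < n) {ℓ : ℝ → ℝ → ℝ} {L : ℝ≥0} {x : Fin n → X}
    {y : Fin n → ℝ} (hL : ∀ i, LipschitzWith L fun z => ℓ z (y i)) {f g : H} {b : ℝ} (hb : 0 ≤ b)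
    (hfg : (1 / (n : ℝ)) * ∑ i, (g - f) (x i) ^ 2 ≤ b ^ 2) :
    (1 / (n : ℝ)) * ∑ i, ℓ (g (x i)) (y i)
      ≤ (1 / (n : ℝ)) * ∑ i, ℓ (f (x i)) (y i) + L * b := by
  have hn' : (0 : ℝ) < n := by exact_mod_cast hn
  have h1 : (1 / (n : ℝ)) * ∑ i, |(g - f) (x i)| ≤ b := by
    refine le_of_sq_le_sq (le_trans ?_ hfg) hb
    have h := sq_sum_le_card_mul_sum_sq (s := (Finset.univ : Finset (Fin n)))
      (f := fun i => |(g - f) (x i)|)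
    simp only [sq_abs, Finset.card_univ, Fintype.card_fin] at h
    rw [mul_pow]
    calc _ ≤ (1 / (n : ℝ)) ^ 2 * (n * ∑ i, (g - f) (x i) ^ 2) :=
          mul_le_mul_of_nonneg_left h (by positivity)
      _ = _ := by field_simp
  have h2 : ∑ i, ℓ (g (x i)) (y i) ≤ ∑ i, ℓ (f (x i)) (y i) + L * ∑ i, |(g - f) (x i)| := by
    rw [Finset.mul_sum, ← Finset.sum_add_distrib]
    refine Finset.sum_le_sum fun i _ => ?_
    have h := (hL i).dist_le_mul (g (x i)) (f (x i))
    rw [Real.dist_eq, Real.dist_eq] at h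
    have h' := (le_abs_self _).trans h
    rw [RKHS.coe_sub, Pi.sub_apply]
    linarith
  calc _ ≤ (1 / (n : ℝ)) * (∑ i, ℓ (f (x i)) (y i) + L * ∑ i, |(g - f) (x i)|) :=
        mul_le_mul_of_nonneg_left h2 (by positivity)
    _ = (1 / (n : ℝ)) * ∑ i, ℓ (f (x i)) (y i) + L * ((1 / (n : ℝ)) * ∑ i, |(g - f) (x i)|) := by
        ring
    _ ≤ _ := by
        have := mul_le_mul_of_nonneg_left h1 L.coe_nonneg
        linarith

/-- Isolates the part linear in the residual, to be handled by optimality, from the quadratic part,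
which the approximation bound controls directly. -/
theorem empirical_squared_eq {ℓ : ℝ → ℝ → ℝ} (hsq : ∀ z y : ℝ, ℓ z y = (z - y) ^ 2 / 2)
    (x : Fin n → X) (y : Fin n → ℝ) (f g : H) :
    (1 / (n : ℝ)) * ∑ k, ℓ (g (x k)) (y k)
      = (1 / (n : ℝ)) * ∑ k, ((f (x k) - y k) ^ 2 / 2 + (f (x k) - y k) * (g - f) (x k))
        + (1 / (n : ℝ)) * (∑ k, (g - f) (x k) ^ 2) / 2 := by
  rw [mul_div_assoc, ← mul_add, Finset.sum_div, ← Finset.sum_add_distrib]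
  congr 1
  refine Finset.sum_congr rfl fun k _ => ?_
  rw [hsq, RKHS.coe_sub, Pi.sub_apply]
  ring

end Sampling

/-! ### The squared loss: first order optimality and linearisation -/

section SquaredLoss

variable {X : Type*} [MeasurableSpace X] {H : Type*} [NormedAddCommGroup H]
  [InnerProductSpace ℝ H] [CompleteSpace H] [RKHS ℝ H X ℝ] {κ : ℝ} {𝒴 : Set ℝ}
  {P : Measure (X × ℝ)} [IsProbabilityMeasure P] {ℓ : ℝ → ℝ → ℝ} {n : ℕ}

/-- Boundedness of the squared loss forces `κ ≤ 4`. -/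
theorem sqrt_le_two_of_squared_loss (hP : ∀ᵐ p ∂P, p.2 ∈ 𝒴)
    (hbdd : ∀ y ∈ 𝒴, ∀ z : ℝ, |z| ≤ √κ → 0 ≤ ℓ z y ∧ ℓ z y ≤ 2)
    (hsq : ∀ z y : ℝ, ℓ z y = (z - y) ^ 2 / 2) (h𝒴 : 𝒴 ⊆ Icc 0 1) : √κ ≤ 2 := by
  obtain ⟨p, hp⟩ := hP.exists
  have h1 := (hbdd p.2 hp (-√κ) (by rw [abs_neg, abs_of_nonneg (Real.sqrt_nonneg κ)])).2
  have h2 := (h𝒴 hp).1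
  rw [hsq] at h1
  have h3 := Real.sqrt_nonneg κ
  by_contra! hlt
  nlinarith

theorem squared_loss_lipschitz (hsq : ∀ z y : ℝ, ℓ z y = (z - y) ^ 2 / 2) {y b : ℝ}
    (hy : y ∈ Icc (0 : ℝ) 1) {z z' : ℝ} (hz : |z| ≤ b) (hz' : |z'| ≤ b) :
    |ℓ z y - ℓ z' y| ≤ (b + 1) * |z - z'| := by
  have h : ℓ z y - ℓ z' y = ((z + z') / 2 - y) * (z - z') := by rw [hsq, hsq]; ring
  rw [h, abs_mul]
  refine mul_le_mul_of_nonneg_right ?_ (abs_nonneg _)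
  rw [abs_le] at *
  constructor <;> linarith [hz.1, hz.2, hz'.1, hz'.2, hy.1, hy.2]

/-- The first order optimality condition at a minimiser of the squared risk. -/
theorem integral_residual_mul_eq_zero (hker : Measurable fun p : X × X => ker H p.1 p.2)
    (hκ : ∀ x x' : X, ker H x x' ≤ κ) (hP : ∀ᵐ p ∂P, p.2 ∈ 𝒴)
    (hsq : ∀ z y : ℝ, ℓ z y = (z - y) ^ 2 / 2) (h𝒴 : 𝒴 ⊆ Icc 0 1)
    {f : H} (hf : ‖f‖ ≤ 1) (hmin : ∀ g : H, risk P ℓ f ≤ risk P ℓ g) {h : H} (hh : ‖h‖ ≤ 1) :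
    ∫ p, ((f p.1 - p.2) ^ 2 / 2 + (f p.1 - p.2) * h p.1) ∂P = risk P ℓ f := by
  have hfm : Measurable fun p : X × ℝ => f p.1 :=
    (measurable_coe_of_measurable_ker hker f).comp measurable_fst
  have hhm : Measurable fun p : X × ℝ => h p.1 :=
    (measurable_coe_of_measurable_ker hker h).comp measurable_fst
  have ham : Measurable fun p : X × ℝ => f p.1 - p.2 := hfm.sub measurable_snd
  have hab : ∀ᵐ p ∂P, |f p.1 - p.2| ≤ √κ + 1 := by
    filter_upwards [hP] with p hp
    have h1 := abs_le.1 (abs_apply_le hκ hf p.1)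
    have h2 := h𝒴 hp
    rw [abs_le]
    constructor <;> linarith [h1.1, h1.2, h2.1, h2.2]
  have hhb : ∀ p : X × ℝ, |h p.1| ≤ √κ := fun p => abs_apply_le hκ hh p.1
  have hκ0 := Real.sqrt_nonneg κ
  have i1 : Integrable (fun p : X × ℝ => (f p.1 - p.2) ^ 2 / 2) P := by
    refine Integrable.of_bound ((ham.pow_const 2).div_const 2).aestronglyMeasurable
      ((√κ + 1) ^ 2 / 2) ?_
    filter_upwards [hab] with p hp
    rw [Real.norm_of_nonneg (by positivity), ← sq_abs]
    gcongr
  have i2 : Integrable (fun p : X × ℝ => (f p.1 - p.2) * h p.1) P := by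
    refine Integrable.of_bound (ham.mul hhm).aestronglyMeasurable ((√κ + 1) * √κ) ?_
    filter_upwards [hab] with p hp
    rw [Real.norm_eq_abs, abs_mul]
    exact mul_le_mul hp (hhb p) (abs_nonneg _) (by positivity)
  have i3 : Integrable (fun p : X × ℝ => h p.1 ^ 2 / 2) P := by
    refine Integrable.of_bound ((hhm.pow_const 2).div_const 2).aestronglyMeasurable
      (√κ ^ 2 / 2) (Filter.Eventually.of_forall fun p => ?_)
    rw [Real.norm_of_nonneg (by positivity), ← sq_abs]
    have := hhb p
    gcongr
  set b := ∫ p, (f p.1 - p.2) * h p.1 ∂P with hb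
  set e := ∫ p, h p.1 ^ 2 / 2 ∂P with he
  have he0 : 0 ≤ e := integral_nonneg fun p => by positivity
  have hrisk : risk P ℓ f = ∫ p, (f p.1 - p.2) ^ 2 / 2 ∂P := by
    unfold risk; simp_rw [hsq]
  have hexpand : ∀ t : ℝ, risk P ℓ (f + t • h : H) = risk P ℓ f + t * b + t ^ 2 * e := fun t => by
    have i12 : Integrable (fun p : X × ℝ =>
        (f p.1 - p.2) ^ 2 / 2 + t * ((f p.1 - p.2) * h p.1)) P :=
      i1.add (i2.const_mul t)
    rw [hrisk, hb, he, ← integral_const_mul, ← integral_const_mul,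
      ← integral_add i1 (i2.const_mul t),
      ← integral_add i12 (i3.const_mul _)]
    unfold risk
    refine integral_congr_ae (Filter.Eventually.of_forall fun p => ?_)
    simp only [hsq, RKHS.coe_add, RKHS.coe_smul, Pi.add_apply, Pi.smul_apply, smul_eq_mul]
    ring
  have hb0 : b = 0 := by
    -- The trial step `-b / (e + 1)` changes the risk by exactly `-(b / (e + 1))²`; the `+ 1` avoids
    -- division by zero when `e = 0`.
    have h1 := hmin (f + (-(b / (e + 1))) • h)
    rw [hexpand] at h1
    have h2 : -(b / (e + 1)) * b + (-(b / (e + 1))) ^ 2 * e = -(b / (e + 1)) ^ 2 := by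
      field_simp; ring
    have h3 : (b / (e + 1)) ^ 2 = 0 := le_antisymm (by linarith) (sq_nonneg _)
    have h4 := pow_eq_zero_iff two_ne_zero |>.1 h3
    rcases div_eq_zero_iff.1 h4 with h5 | h5
    · exact h5
    · linarith
  rw [integral_add i1 i2, ← hb, hb0, add_zero, hrisk]

/-- With high probability, the linearised empirical squared risk at the minimiser is controlled
by the minimal risk. -/
theorem linearised_empirical_le_risk (hker : Measurable fun p : X × X => ker H p.1 p.2)
    (hκ : ∀ x x' : X, ker H x x' ≤ κ) (hP : ∀ᵐ p ∂P, p.2 ∈ 𝒴)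
    (hbdd : ∀ y ∈ 𝒴, ∀ z : ℝ, |z| ≤ √κ → 0 ≤ ℓ z y ∧ ℓ z y ≤ 2)
    (hsq : ∀ z y : ℝ, ℓ z y = (z - y) ^ 2 / 2) (h𝒴 : 𝒴 ⊆ Icc 0 1)
    {f : H} (hf : ‖f‖ ≤ 1) (hmin : ∀ g : H, risk P ℓ f ≤ risk P ℓ g)
    (hn : 0 < n) {δ : ℝ} (hδ : δ ∈ Ioo (0 : ℝ) 1) :
    ∃ A : Set (Fin n → X × ℝ), MeasurableSet A ∧
      1 - ENNReal.ofReal δ ≤ Measure.pi (fun _ : Fin n => P) A ∧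
      ∀ D ∈ A, ∀ g : H, ‖g‖ ≤ 1 → ‖g - f‖ ≤ 1 →
        (1 / (n : ℝ)) * ∑ k, ((f (D k).1 - (D k).2) ^ 2 / 2
            + (f (D k).1 - (D k).2) * (g - f) (D k).1)
          ≤ risk P ℓ f + 2 * (√κ + 1) * √(κ / n) + 4 * √(Real.log (1 / δ) / (2 * n)) := by
  obtain ⟨E, hE, hPE, hE𝒴⟩ := exists_measurableSet_ae_subset hP
  have hκ0 := Real.sqrt_nonneg κ
  have hκ2 := sqrt_le_two_of_squared_loss hP hbdd hsq h𝒴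
  have hfm : Measurable fun p : X × ℝ => f p.1 :=
    (measurable_coe_of_measurable_ker hker f).comp measurable_fst
  have hfb : ∀ p : X × ℝ, f p.1 ∈ Icc (-√κ) √κ := fun p => abs_le.1 (abs_apply_le hκ hf p.1)
  have ham : Measurable fun q : (X × ℝ) × ℝ => f q.1.1 - q.1.2 :=
    (hfm.sub measurable_snd).comp measurable_fst
  have hψm : Measurable fun q : (X × ℝ) × ℝ =>
      -((f q.1.1 - q.1.2) ^ 2 / 2 + (f q.1.1 - q.1.2) * q.2) := by fun_prop
  obtain ⟨L, hL⟩ : ∃ L : ℝ≥0, (L : ℝ) = √κ + 1 := ⟨⟨√κ + 1, by positivity⟩, rfl⟩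
  -- The sign is reversed because the deviation bound goes from empirical to true averages. The
  -- variable `t` is the value of the residual, and the window keeps both `t` and `f + t` in `[-√κ,
  -- √κ]`. The function equals `t² / 2 - (f + t - y)² / 2`, a difference of two numbers in `[0, 2]`;
  -- hence `a = -2` and `w = 4`.
  obtain ⟨A, hA, hPA, hAD⟩ := uniform_deviation_of_mem_Icc (P := P) (n := n)
    (ξ := fun p : X × ℝ => kerSection H p.1)
    (φ := fun p t => -((f p.1 - p.2) ^ 2 / 2 + (f p.1 - p.2) * t)) (a := -2) (w := 4)
    (L := L)
    (κ := κ) hn (measurable_inner_kerSection hker)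
    (fun p => by rw [norm_kerSection_sq]; exact hκ _ _)
    (fun g => by
      simp_rw [inner_kerSection]
      exact (measurable_coe_of_measurable_ker hker g).comp measurable_fst)
    hψm four_pos hE hPE (lo := fun p => max (-√κ) (-√κ - f p.1))
    (hi := fun p => min √κ (√κ - f p.1))
    (measurable_const.max (measurable_const.sub hfm))
    (measurable_const.min (measurable_const.sub hfm))
    (fun p _ => by
      have h := hfb p
      exact (max_le (by linarith) (by linarith [h.1])).trans
        (le_min hκ0 (by linarith [h.2]) : (0 : ℝ) ≤ _))
    (fun p hp t ht => by
      obtain ⟨h1, h2⟩ := max_le_iff.1 ht.1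
      obtain ⟨h3, h4⟩ := le_min_iff.1 ht.2
      have h5 := hbdd p.2 (hE𝒴 p hp) (f p.1 + t) (abs_le.2 ⟨by linarith, by linarith⟩)
      rw [hsq] at h5
      have h6 : t ^ 2 ≤ 4 := by nlinarith
      have h7 : -((f p.1 - p.2) ^ 2 / 2 + (f p.1 - p.2) * t)
          = t ^ 2 / 2 - (f p.1 + t - p.2) ^ 2 / 2 := by ring
      rw [h7]
      constructor <;> linarith [h5.1, h5.2, sq_nonneg t])
    (fun p hp t ht t' ht' => by
      have h1 : -((f p.1 - p.2) ^ 2 / 2 + (f p.1 - p.2) * t)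
          - -((f p.1 - p.2) ^ 2 / 2 + (f p.1 - p.2) * t') = -(f p.1 - p.2) * (t - t') := by ring
      rw [h1, abs_mul, abs_neg]
      refine mul_le_mul_of_nonneg_right ?_ (abs_nonneg _)
      have h2 := hfb p
      have h3 := h𝒴 (hE𝒴 p hp)
      rw [abs_le, hL]
      constructor <;> linarith [h2.1, h2.2, h3.1, h3.2])
    hδ
  refine ⟨A, hA, hPA, fun D hD g hg hgf => ?_⟩
  have h := (hAD D hD).2 (g - f) hgf fun p _ => by
    rw [inner_kerSection]
    have h1 := abs_le.1 (abs_apply_le hκ hgf p.1)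
    have h2 := abs_le.1 (abs_apply_le hκ hg p.1)
    refine ⟨max_le h1.1 ?_, le_min h1.2 ?_⟩
    · rw [RKHS.coe_sub, Pi.sub_apply]; linarith [h2.1]
    · rw [RKHS.coe_sub, Pi.sub_apply]; linarith [h2.2]
  simp only [inner_kerSection] at h
  rw [integral_neg, integral_residual_mul_eq_zero hker hκ hP hsq h𝒴 hf hmin hgf,
    Finset.sum_neg_distrib, mul_neg, hL] at h
  linarith

end SquaredLoss

theorem one_add_sqrt_two_mul_le {c : ℝ} (hc : 0 < c) : 1 + √2 * c ≤ 1 + √6 * c := by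
  have : √(2 : ℝ) ≤ √6 := Real.sqrt_le_sqrt (by norm_num)
  gcongr

end SketchedKernel

/-! ### Assembly of the two bounds -/

theorem theorem2
    -- input space, RKHS of real functions on it, and law of the data
    {X : Type*} [MeasurableSpace X]
    {H : Type*} [NormedAddCommGroup H] [InnerProductSpace ℝ H] [CompleteSpace H] [RKHS ℝ H X ℝ]
    (hker : Measurable fun p : X × X => SketchedKernel.ker H p.1 p.2)
    (κ : ℝ) (hκ : ∀ x x' : X, SketchedKernel.ker H x x' ≤ κ)
    (𝒴 : Set ℝ) (P : Measure (X × ℝ)) [IsProbabilityMeasure P] (hP : ∀ᵐ p ∂P, p.2 ∈ 𝒴)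
    -- loss, with values in `[0, 2]` on the range of the predictions
    (ℓ : ℝ → ℝ → ℝ) (hℓ : Measurable (Function.uncurry ℓ))
    (hbdd : ∀ y ∈ 𝒴, ∀ z : ℝ, |z| ≤ √κ → 0 ≤ ℓ z y ∧ ℓ z y ≤ 2)
    -- the minimiser of the true risk, in the unit ball
    (fH : H) (hfH : ‖fH‖ ≤ 1)
    (hmin : ∀ f : H, SketchedKernel.risk P ℓ fH ≤ SketchedKernel.risk P ℓ f)
    -- sample size, sketch size, regularisation parameter, satisfiability constant, confidence
    (n : ℕ) (hn : 0 < n) (s : ℕ) (lam : ℝ) (hlam : 0 < lam) (c : ℝ) (hc : 0 < c)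
    (δ : ℝ) (hδ : δ ∈ Set.Ioo (0 : ℝ) 1) :
    (∀ L : ℝ≥0, (∀ y ∈ 𝒴, LipschitzWith L fun z => ℓ z y) →
      ∃ A : Set (Fin n → X × ℝ), MeasurableSet A ∧
        1 - ENNReal.ofReal δ ≤ Measure.pi (fun _ : Fin n => P) A ∧
        ∀ D ∈ A, ∀ (U : Matrix (Fin n) (Fin n) ℝ) (μ : Fin n → ℝ),
          SketchedKernel.IsEigendecomposition
            ((1 / (n : ℝ)) • SketchedKernel.gram H fun i => (D i).1) U μ →
          ∀ S : Matrix (Fin s) (Fin n) ℝ, SketchedKernel.IsSatisfiable U μ c S →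
          ∀ γ : Fin s → ℝ,
            SketchedKernel.IsSketchedSolution H ℓ lam (fun i => (D i).1) (fun i => (D i).2) S γ →
            SketchedKernel.risk P ℓ (SketchedKernel.sketchedFun H (fun i => (D i).1) S γ) ≤
              SketchedKernel.risk P ℓ fH
              + L * (1 + √6 * c) * √(lam + SketchedKernel.criticalRadius μ ^ 2) + lam / 2
              + 8 * L * √(κ / n) + 2 * √(8 * Real.log (4 / δ) / n)) ∧
    ((∀ z y : ℝ, ℓ z y = (z - y) ^ 2 / 2) → 𝒴 ⊆ Set.Icc 0 1 →
      ∃ A : Set (Fin n → X × ℝ), MeasurableSet A ∧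
        1 - ENNReal.ofReal δ ≤ Measure.pi (fun _ : Fin n => P) A ∧
        ∀ D ∈ A, ∀ (U : Matrix (Fin n) (Fin n) ℝ) (μ : Fin n → ℝ),
          SketchedKernel.IsEigendecomposition
            ((1 / (n : ℝ)) • SketchedKernel.gram H fun i => (D i).1) U μ →
          ∀ S : Matrix (Fin s) (Fin n) ℝ, SketchedKernel.IsSatisfiable U μ c S →
          ∀ γ : Fin s → ℝ,
            SketchedKernel.IsSketchedSolution H ℓ lam (fun i => (D i).1) (fun i => (D i).2) S γ →
            SketchedKernel.risk P ℓ (SketchedKernel.sketchedFun H (fun i => (D i).1) S γ) ≤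
              SketchedKernel.risk P ℓ fH
              + ((1 + √6 * c) ^ 2 + 1 / 2) * lam
              + (1 + √6 * c) ^ 2 * SketchedKernel.criticalRadius μ ^ 2
              + 8 * ((κ + √κ) / √n) + 2 * √(8 * Real.log (4 / δ) / n)) := by
  have hκ0 := SketchedKernel.nonneg_of_ker_le P hκ
  have hδ2 : δ / 2 ∈ Ioo (0 : ℝ) 1 := ⟨half_pos hδ.1, by linarith [hδ.1, hδ.2]⟩
  have hq := SketchedKernel.sqrt_log_half_le hn hδ
  have hq0 : 0 ≤ √(8 * Real.log (4 / δ) / n) := Real.sqrt_nonneg _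
  have hδsum : δ / 2 + δ / 2 = δ := add_halves δ
  have hC := SketchedKernel.one_add_sqrt_two_mul_le hc
  refine ⟨fun L hL => ?_, fun hsq h𝒴 => ?_⟩
  · obtain ⟨A₁, hA₁, hPA₁, hAD₁⟩ := SketchedKernel.risk_le_empirical (n := n) hker hκ hP hℓ hbdd
      (L := L) (fun y hy z z' _ _ => by
        simpa only [Real.dist_eq] using (hL y hy).dist_le_mul z z') hn hδ2
    obtain ⟨A₂, hA₂, hPA₂, hAD₂⟩ :=
      SketchedKernel.empirical_le_risk (n := n) hker hκ hP hℓ hbdd hn hδ2 hfH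
    have hPA := SketchedKernel.one_sub_ofReal_add_le_measure_inter hA₁ hA₂ hδ2.1.le hδ2.1.le
      hPA₁ hPA₂
    rw [hδsum] at hPA
    refine ⟨A₁ ∩ A₂, hA₁.inter hA₂, hPA, fun D hD U μ hU S hS γ hγ => ?_⟩
    obtain ⟨γ', hγ'1, -, hγ'2⟩ := SketchedKernel.exists_sketchedFun_approx hn hU hc hS hfH
    have h1 := (hAD₁ D hD.1).2 _ hγ.1
    have h2 := SketchedKernel.empirical_le_of_isSketchedSolution hlam hγ hγ'1
    have hr0 := SketchedKernel.criticalRadius_nonneg μ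
    have h3 := SketchedKernel.empirical_lipschitz_le hn (fun i => hL _ ((hAD₁ D hD.1).1 i))
      (by positivity) hγ'2
    have h4 := hAD₂ D hD.2
    have h5 : (L : ℝ) * ((1 + √2 * c) * SketchedKernel.criticalRadius μ)
        ≤ L * (1 + √6 * c) * √(lam + SketchedKernel.criticalRadius μ ^ 2) := by
      rw [mul_assoc]
      refine mul_le_mul_of_nonneg_left (mul_le_mul hC ?_ hr0 (by positivity)) L.coe_nonneg
      exact Real.le_sqrt_of_sq_le (by linarith)
    have h6 : 0 ≤ (L : ℝ) * √(κ / n) := by positivity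
    -- The concentration terms sum to at most one copy of `√(8 * log (4 / δ) / n)`, and the
    -- complexity term has factor 2 where 8 is allowed.
    linarith
  · have hκs := Real.sqrt_nonneg κ
    obtain ⟨L, hL⟩ : ∃ L : ℝ≥0, (L : ℝ) = √κ + 1 := ⟨⟨√κ + 1, by positivity⟩, rfl⟩
    obtain ⟨A₁, hA₁, hPA₁, hAD₁⟩ := SketchedKernel.risk_le_empirical (n := n) hker hκ hP hℓ hbdd
      (L := L) (fun y hy z z' hz hz' => by
        rw [hL]; exact SketchedKernel.squared_loss_lipschitz hsq (h𝒴 hy) hz hz') hn hδ2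
    obtain ⟨A₂, hA₂, hPA₂, hAD₂⟩ := SketchedKernel.linearised_empirical_le_risk (n := n) hker hκ hP
      hbdd hsq h𝒴 hfH hmin hn hδ2
    have hPA := SketchedKernel.one_sub_ofReal_add_le_measure_inter hA₁ hA₂ hδ2.1.le hδ2.1.le
      hPA₁ hPA₂
    rw [hδsum] at hPA
    refine ⟨A₁ ∩ A₂, hA₁.inter hA₂, hPA, fun D hD U μ hU S hS γ hγ => ?_⟩
    obtain ⟨γ', hγ'1, hγ'f, hγ'2⟩ := SketchedKernel.exists_sketchedFun_approx hn hU hc hS hfH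
    have h1 := (hAD₁ D hD.1).2 _ hγ.1
    have h2 := SketchedKernel.empirical_le_of_isSketchedSolution hlam hγ hγ'1
    rw [SketchedKernel.empirical_squared_eq hsq (fun i => (D i).1) (fun i => (D i).2) fH
      (SketchedKernel.sketchedFun H (fun i => (D i).1) S γ')] at h2
    have h3 := hAD₂ D hD.2 _ hγ'1 hγ'f
    have hr0 := SketchedKernel.criticalRadius_nonneg μ
    have h4 : ((1 + √2 * c) * SketchedKernel.criticalRadius μ) ^ 2
        ≤ (1 + √6 * c) ^ 2 * SketchedKernel.criticalRadius μ ^ 2 := by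
      rw [mul_pow]
      gcongr
    have h5 : (√κ + 1) * √(κ / n) = (κ + √κ) / √n := by
      rw [Real.sqrt_div hκ0, mul_div_assoc', add_mul, Real.mul_self_sqrt hκ0, one_mul]
    have h6 : 0 ≤ (κ + √κ) / √n := by positivity
    have h7 : 0 ≤ (1 + √6 * c) ^ 2 * lam := by positivity
    have h8 : 0 ≤ (1 + √6 * c) ^ 2 * SketchedKernel.criticalRadius μ ^ 2 := by positivity
    rw [hL] at h1
    rw [mul_assoc, h5] at h1 h3
    -- Two complexity terms give factor 4 where 8 is allowed. The concentration terms, of widths 2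
    -- and 4, give factor `6 / 4` where 2 is allowed. The quadratic residual contributes half of
    -- `h4`.
    linarith
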